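/- **Setting.** Let $\dot x = Ax + Bu$, $y = Cx$ be an agent with $x\in\mathbb R^n$, $u\in\mathbb R^m$, $y\in\mathbb R^p$, such that $(A,B)$ is stabilizable and $(A,C)$ is detectable. Let the exosystem matrix be $\bar A=\mathrm{diag}(0_{m_0\times m_0},\,\omega_1(I_{m_1}\otimes J),\dots,\omega_N(I_{m_N}\otimes J))\in\mathbb R^{\bar n\times\bar n}$, with $J=\begin{pmatrix}0&1\\-1&0\end{pmatrix}$, pairwise different $\omega_j>0$, multiplicities $m_j\ge 1$, and $\omega_i/\omega_j\in\mathbb Q$ for all $i,j$ (so all eigenvalues of $\bar A$ are semisimple with zero real part). Let $\bar C\in\mathbb R^{p\times\bar n}$, $\bar x(t)=e^{\bar A t}\bar x(0)$, and $R\succ0$. Write $\bar x_l$ for the states of the $m_0$ constant scalar subsystems and $\hat x_h\in\mathbb R^2$ for the states of the harmonic subsystems. The normalized set of initial values is $$\bar{\mathcal X}=\{\bar x : |\bar x_l|\le 1\ \forall l,\ \|\hat x_h\|_2\le 1\ \forall h\},$$ and $\bar x_B=(1,\dots,1,0,1,\dots,0,1)^\top$ (entry $1$ for each constant subsystem, $(0,1)$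 for each harmonic one). Assume that the regulator equations $\Pi\bar A=A\Pi+B\Gamma$, $C\Pi-\bar C=0$ have a solution $(\Pi,\Gamma)$. **Optimization problem.** Given $\epsilon_1,\dots,\epsilon_p>0$, minimize $\mathrm{trace}(\Gamma^\top R\Gamma)$ over $(\Pi,\Gamma,\Pi_\lambda,Q,P,X)$ with symmetric $Q\succ0$, $P\succ0$, $X\succ0$ subject to $$\begin{pmatrix}\Pi\\ \Pi_\lambda\end{pmatrix}\bar A=\begin{pmatrix}A&-BR^{-1}B^\top\\-C^\top QC&-A^\top\end{pmatrix}\begin{pmatrix}\Pi\\ \Pi_\lambda\end{pmatrix}+\begin{pmatrix}0\\ C^\top Q\bar C\end{pmatrix},\qquad \Gamma=-R^{-1}B^\top\Pi_\lambda,$$ $$P\bar A+\bar A^\top P=0,\qquad \bar x_B^\top P\bar x_B\le1,\qquad e_j^\top Xe_j\le\epsilon_j^2\ \ \forall j,\qquad \begin{pmatrix}P&(C\Pi-\bar C)^\top\\ C\Pi-\bar C&X\end{pmatrix}\succ0,$$ where $P$ is block-diagonal with one block for each constant or harmonic subsystem. **Definition.** $(\Pi,\Gamma)$ gives *optimal stationary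 synchronization* (OSS) for the weights $(Q,R)$ if $\Pi\bar A=A\Pi+B\Gamma$ and the following holds for every $K$ with $A-BK$ Hurwitz, all $\bar x(0)$ and $x(0)$, and every continuous local exosystem state $\bar x_{\mathrm{loc}}$ with $\bar x_{\mathrm{loc}}(t)-\bar x(t)\to0$ exponentially (for example $\bar x_{\mathrm{loc}}=\bar x$). Let $(x,u)$ be the closed-loop trajectory from $x(0)$ under $u=-K(x-\Pi\bar x_{\mathrm{loc}})+\Gamma\bar x_{\mathrm{loc}}$. Then for any locally integrable control $\hat u$ with state trajectory $\hat x$ from the same $x(0)$ for which $\hat x(t)-\Pi\bar x(t)$ does not converge to $0$, $$\lim_{t_f\to\infty}\bigl(J_{t_f}(C\hat x-\bar C\bar x,\hat u)-J_{t_f}(Cx-\bar C\bar x,u)\bigr)=+\infty,\qquad J_{t_f}(\tilde y,u)=\tfrac12\int_0^{t_f}\bigl(\tilde y^\top Q\tilde y+u^\top Ru\bigr)\,dt\in[0,\infty].$$ It gives *error-bounded* OSS (EBOSS) on a set $\mathcal S$ if, in addition, $|e_j^\top(C\Pi-\bar C)\bar x(t)|\le\epsilon_j$ for all $\bar x(0)\in\mathcal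 S$, all $t\ge0$ and all $j$. **Theorem.** For any $\epsilon_1,\dots,\epsilon_p>0$: 1. The optimization problem is solvable up to any accuracy: for every $\eta>0$ there is a feasible point whose objective is within $\eta$ of that of every feasible point (in particular, feasible points exist). 2. For every exact or approximate minimizer, the pair $(\Pi,\Gamma)$ gives EBOSS on $\bar{\mathcal X}$ for the weights $(Q,R)$, with the minimizer's own $Q$. 3. More generally, for every feasible point, $\bar{\mathcal X}\subseteq\{\chi : \chi^\top P\chi\le1\}$, and $(\Pi,\Gamma)$ gives EBOSS on this ellipsoid for the weights $(Q,R)$. -/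

import Mathlib

open scoped Matrix ENNReal Topology

namespace OptSync

noncomputable section

/-- Index type of the exosystem state: `m₀` scalar constant subsystems, followed by the harmonic
second-order subsystems. The `j`-th of the `N` different nonzero frequencies occurs with
multiplicity `mult j`. -/
abbrev ExoIdx (m₀ : ℕ) {N : ℕ} (mult : Fin N → ℕ) : Type :=
  Fin m₀ ⊕ ((Σ j : Fin N, Fin (mult j)) × Fin 2)

/-- The exosystem matrix `diag (0, ω₁ (I ⊗ J), …, ω_N (I ⊗ J))` with `J = [0, 1; -1, 0]`. -/
def exoMatrix (m₀ : ℕ) {N : ℕ} (mult : Fin N → ℕ) (ω : Fin N → ℝ) :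
    Matrix (ExoIdx m₀ mult) (ExoIdx m₀ mult) ℝ :=
  Matrix.fromBlocks 0 0 0
    (Matrix.kroneckerMap (· * ·)
      (Matrix.diagonal fun h : (Σ j : Fin N, Fin (mult j)) => ω h.1) !![0, 1; -1, 0])

/-- The subsystem (constant or harmonic) to which a coordinate of the exosystem belongs. -/
def subsystem {m₀ N : ℕ} {mult : Fin N → ℕ} :
    ExoIdx m₀ mult → Fin m₀ ⊕ (Σ j : Fin N, Fin (mult j)) :=
  Sum.map id Prod.fst

/-- The vector `(1, …, 1, 0, 1, …, 0, 1)`: the entry `1` for every constant subsystem and the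
entries `(0, 1)` for every harmonic subsystem. -/
def boundaryVec {m₀ N : ℕ} {mult : Fin N → ℕ} : ExoIdx m₀ mult → ℝ :=
  Sum.elim (fun _ => 1) (fun hk => ![0, 1] hk.2)

/-- Exosystem states with all step heights and all harmonic amplitudes bounded by one. -/
def normalizedSet (m₀ : ℕ) {N : ℕ} (mult : Fin N → ℕ) : Set (ExoIdx m₀ mult → ℝ) :=
  {x | (∀ l, |x (Sum.inl l)| ≤ 1) ∧
    ∀ h, Real.sqrt (x (Sum.inr (h, 0)) ^ 2 + x (Sum.inr (h, 1)) ^ 2) ≤ 1}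

/-- The ellipsoid `{x | xᵀ P x ≤ 1}`. -/
def ellipsoid {ι : Type*} [Fintype ι] (P : Matrix ι ι ℝ) : Set (ι → ℝ) :=
  {x | x ⬝ᵥ (P *ᵥ x) ≤ 1}

/-- All complex eigenvalues of the real matrix `M` have negative real part. -/
def IsHurwitz {ι : Type*} [Fintype ι] [DecidableEq ι] (M : Matrix ι ι ℝ) : Prop :=
  ∀ z ∈ spectrum ℂ (M.map (algebraMap ℝ ℂ)), z.re < 0

def IsStabilizable {n m : ℕ} (A : Matrix (Fin n) (Fin n) ℝ) (B : Matrix (Fin n) (Fin m) ℝ) :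
    Prop :=
  ∃ K : Matrix (Fin m) (Fin n) ℝ, IsHurwitz (A - B * K)

def IsDetectable {n p : ℕ} (A : Matrix (Fin n) (Fin n) ℝ) (C : Matrix (Fin p) (Fin n) ℝ) :
    Prop :=
  ∃ L : Matrix (Fin n) (Fin p) ℝ, IsHurwitz (A - L * C)

/-- The synchronized trajectory `x̄(t) = exp(Ā t) x̄(0)`. -/
def exoTraj {ι : Type*} [Fintype ι] [DecidableEq ι] (Abar : Matrix ι ι ℝ) (xbar0 : ι → ℝ)
    (t : ℝ) : ι → ℝ :=
  NormedSpace.exp (t • Abar) *ᵥ xbar0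

/-- `x` is the (absolutely continuous) solution on `[0, ∞)` of `ẋ = A x + B u`, `x(0) = x0`,
for a locally integrable input `u`. -/
def IsStateTraj {n m : ℕ} (A : Matrix (Fin n) (Fin n) ℝ) (B : Matrix (Fin n) (Fin m) ℝ)
    (u : ℝ → Fin m → ℝ) (x0 : Fin n → ℝ) (x : ℝ → Fin n → ℝ) : Prop :=
  (∀ T, 0 ≤ T → IntervalIntegrable u MeasureTheory.volume 0 T) ∧
  ContinuousOn x (Set.Ici 0) ∧
  ∀ t, 0 ≤ t → x t = x0 + ∫ s in (0 : ℝ)..t, (A *ᵥ x s + B *ᵥ u s)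

/-- The quadratic cost `½ ∫₀^{tf} eᵀ Q e + uᵀ R u dt`, with value `∞` if the integral diverges.
It is used with positive definite `Q` and `R`, so the integrand is nonnegative. -/
def cost {m p : ℕ} (Q : Matrix (Fin p) (Fin p) ℝ) (R : Matrix (Fin m) (Fin m) ℝ)
    (e : ℝ → Fin p → ℝ) (u : ℝ → Fin m → ℝ) (tf : ℝ) : ℝ≥0∞ :=
  2⁻¹ * ∫⁻ t in Set.Icc 0 tf, ENNReal.ofReal (e t ⬝ᵥ (Q *ᵥ e t) + u t ⬝ᵥ (R *ᵥ u t))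

/-- The tracking control `u = -K (x - Π x̄ᵢ) + Γ x̄ᵢ` of an agent with state `x` and local
exosystem state `x̄ᵢ`. -/
def trackingControl {n m : ℕ} {ι : Type*} [Fintype ι] (K : Matrix (Fin m) (Fin n) ℝ)
    (Pi : Matrix (Fin n) ι ℝ) (Gam : Matrix (Fin m) ι ℝ)
    (x : ℝ → Fin n → ℝ) (xloc : ℝ → ι → ℝ) (t : ℝ) : Fin m → ℝ :=
  -(K *ᵥ (x t - Pi *ᵥ xloc t)) + Gam *ᵥ xloc t

/-- The agent's exosystem state `xloc` is synchronized with the trajectory `xbar`: it is continuous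
and approaches `xbar` exponentially. The choice `xloc = xbar` is included. -/
def IsSynchronized {ι : Type*} [Fintype ι] (xloc xbar : ℝ → ι → ℝ) : Prop :=
  ContinuousOn xloc (Set.Ici 0) ∧
  ∃ c β : ℝ, 0 < β ∧ ∀ t, 0 ≤ t → ‖xloc t - xbar t‖ ≤ c * Real.exp (-β * t)

/-- Optimal stationary synchronization (OSS): for every stabilizing feedback and all initial
values, any other control `u'` from the same initial state whose state trajectory `x'` does not
approach `Π x̄(t)` costs infinitely more than the tracking control, as the horizon tends to
infinity. -/
def IsOSS {n m p : ℕ} {ι : Type*} [Fintype ι] [DecidableEq ι]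
    (A : Matrix (Fin n) (Fin n) ℝ) (B : Matrix (Fin n) (Fin m) ℝ) (C : Matrix (Fin p) (Fin n) ℝ)
    (Abar : Matrix ι ι ℝ) (Cbar : Matrix (Fin p) ι ℝ)
    (Q : Matrix (Fin p) (Fin p) ℝ) (R : Matrix (Fin m) (Fin m) ℝ)
    (Pi : Matrix (Fin n) ι ℝ) (Gam : Matrix (Fin m) ι ℝ) : Prop :=
  Pi * Abar = A * Pi + B * Gam ∧
  ∀ K : Matrix (Fin m) (Fin n) ℝ, IsHurwitz (A - B * K) →
  ∀ (xbar0 : ι → ℝ) (x0 : Fin n → ℝ) (xloc : ℝ → ι → ℝ),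
    IsSynchronized xloc (exoTraj Abar xbar0) →
  ∀ x : ℝ → Fin n → ℝ, IsStateTraj A B (trackingControl K Pi Gam x xloc) x0 x →
  ∀ (u' : ℝ → Fin m → ℝ) (x' : ℝ → Fin n → ℝ), IsStateTraj A B u' x0 x' →
    ¬ Filter.Tendsto (fun t => x' t - Pi *ᵥ exoTraj Abar xbar0 t) Filter.atTop (𝓝 0) →
    Filter.Tendsto
      (fun tf : ℝ =>
        ((cost Q R (fun t => C *ᵥ x' t - Cbar *ᵥ exoTraj Abar xbar0 t) u' tf : ℝ≥0∞) : EReal) -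
        ((cost Q R (fun t => C *ᵥ x t - Cbar *ᵥ exoTraj Abar xbar0 t)
          (trackingControl K Pi Gam x xloc) tf : ℝ≥0∞) : EReal))
      Filter.atTop (𝓝 ⊤)

/-- Error-bounded optimal stationary synchronization (EBOSS) for initial values in `Xbar`: OSS and
`|eⱼᵀ (C Π - C̄) x̄(t)| ≤ εⱼ` for all `x̄(0) ∈ Xbar`, all `t ≥ 0` and all `j`. -/
def IsEBOSS {n m p : ℕ} {ι : Type*} [Fintype ι] [DecidableEq ι]
    (A : Matrix (Fin n) (Fin n) ℝ) (B : Matrix (Fin n) (Fin m) ℝ) (C : Matrix (Fin p) (Fin n) ℝ)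
    (Abar : Matrix ι ι ℝ) (Cbar : Matrix (Fin p) ι ℝ)
    (Q : Matrix (Fin p) (Fin p) ℝ) (R : Matrix (Fin m) (Fin m) ℝ)
    (Xbar : Set (ι → ℝ)) (ε : Fin p → ℝ)
    (Pi : Matrix (Fin n) ι ℝ) (Gam : Matrix (Fin m) ι ℝ) : Prop :=
  IsOSS A B C Abar Cbar Q R Pi Gam ∧
  ∀ xbar0 ∈ Xbar, ∀ t : ℝ, 0 ≤ t → ∀ j : Fin p,
    |((C * Pi - Cbar) *ᵥ exoTraj Abar xbar0 t) j| ≤ ε j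

/-- The decision variables `(Π, Γ, Π_λ, Q, P, X)` of the optimization problem. -/
structure BMIVars (n m p : ℕ) (ι : Type*) where
  Pi : Matrix (Fin n) ι ℝ
  Gam : Matrix (Fin m) ι ℝ
  PiLam : Matrix (Fin n) ι ℝ
  Q : Matrix (Fin p) (Fin p) ℝ
  P : Matrix ι ι ℝ
  X : Matrix (Fin p) (Fin p) ℝ

/-- The objective `trace (Γᵀ R Γ)`. -/
def bmiObjective {n m p : ℕ} {ι : Type*} [Fintype ι] (R : Matrix (Fin m) (Fin m) ℝ)
    (z : BMIVars n m p ι) : ℝ :=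
  (z.Gamᵀ * R * z.Gam).trace

/-- The constraints of the optimization problem. -/
structure BMIFeasible {n m p m₀ N : ℕ} {mult : Fin N → ℕ} (ω : Fin N → ℝ)
    (A : Matrix (Fin n) (Fin n) ℝ) (B : Matrix (Fin n) (Fin m) ℝ) (C : Matrix (Fin p) (Fin n) ℝ)
    (Cbar : Matrix (Fin p) (ExoIdx m₀ mult) ℝ) (R : Matrix (Fin m) (Fin m) ℝ) (ε : Fin p → ℝ)
    (z : BMIVars n m p (ExoIdx m₀ mult)) : Prop where
  Q_pos : z.Q.PosDef
  hamiltonian :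
    Matrix.fromRows z.Pi z.PiLam * exoMatrix m₀ mult ω =
      Matrix.fromBlocks A (-(B * R⁻¹ * Bᵀ)) (-(Cᵀ * z.Q * C)) (-Aᵀ) *
          Matrix.fromRows z.Pi z.PiLam +
        Matrix.fromRows 0 (Cᵀ * z.Q * Cbar)
  gam_eq : z.Gam = -(R⁻¹ * Bᵀ * z.PiLam)
  P_pos : z.P.PosDef
  P_blockDiagonal : ∀ a b, subsystem a ≠ subsystem b → z.P a b = 0
  lyapunov : z.P * exoMatrix m₀ mult ω + (exoMatrix m₀ mult ω)ᵀ * z.P = 0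
  boundary : boundaryVec ⬝ᵥ (z.P *ᵥ boundaryVec) ≤ 1
  X_pos : z.X.PosDef
  X_diag : ∀ j, z.X j j ≤ ε j ^ 2
  schur : (Matrix.fromBlocks z.P (C * z.Pi - Cbar)ᵀ (C * z.Pi - Cbar) z.X).PosDef

/-- `z` is feasible and its objective is minimal up to `η`; for `η = 0` it is a minimizer. -/
def IsBMIMinimizer {n m p m₀ N : ℕ} {mult : Fin N → ℕ} (ω : Fin N → ℝ)
    (A : Matrix (Fin n) (Fin n) ℝ) (B : Matrix (Fin n) (Fin m) ℝ) (C : Matrix (Fin p) (Fin n) ℝ)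
    (Cbar : Matrix (Fin p) (ExoIdx m₀ mult) ℝ) (R : Matrix (Fin m) (Fin m) ℝ) (ε : Fin p → ℝ)
    (η : ℝ) (z : BMIVars n m p (ExoIdx m₀ mult)) : Prop :=
  BMIFeasible ω A B C Cbar R ε z ∧
  ∀ z' : BMIVars n m p (ExoIdx m₀ mult), BMIFeasible ω A B C Cbar R ε z' →
    bmiObjective R z ≤ bmiObjective R z' + η

end

end OptSync

open OptSync

/-! Optimality. Put d = x − Πx̄ and v = u − Γx̄. The regulator equation gives ḋ = Ad + Bv, and the
costate equation makes the bilinear part of the cost the derivative of −(Π_λ x̄)ᵀd. So every cost is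
the sum of a stationary cost common to all controls, a boundary term and the energy ½∫ (Cd)ᵀQ(Cd) +
vᵀRv (`integral_stageCost_eq`). The boundary terms at time 0 cancel between two controls with the
same initial state; at the final time T they are O(‖d(T)‖), because x̄ is bounded. Under the
tracking control d and v decay exponentially, so its energy and boundary term stay bounded. For a
competitor, detectability exhibits d as the state of the Hurwitz system A − LC driven by LCd + Bv,
whose squared norm is at most a multiple of the energy density. Hence convergent energy forces d →
0, and ‖d(T)‖ is at most a constant plus an arbitrarily small multiple of the energy up to T. If d
does not vanish, the energy diverges and beats the boundary term (`tendsto_energy_sub_norm`,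
`isOSS_of_hamiltonian`).

Error bounds. The Lyapunov equation makes x̄ᵀPx̄ constant in time, so the ellipsoid is invariant,
and the last matrix inequality bounds every output error on it. Block structure and Lyapunov
equation force P to be diagonal and scalar on each harmonic block; the form then depends on step
heights and amplitudes only and is largest on the normalized set at `boundaryVec`.

Feasibility. Take Q = qI and minimize the convex quadratic functional q‖CΠ − C̄‖² + tr(ΓᵀRΓ), with
the Frobenius norm, over the solutions of the regulator equation. Since the exosystem matrix is
skew, the stationarity conditions are exactly the Hamiltonian equations, with Π_λ the negative of
the multiplier. Comparison with the exact regulator solution Γ₀ gives q‖CΠ − C̄‖² ≤ tr(Γ₀ᵀRΓ₀), so a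
large q makes the error as small as the matrix inequality needs (`exists_hamiltonian_solution`,
`exists_bmiFeasible`). Approximate minimizers then exist because the objective is nonnegative. -/

namespace OptSync

/-! ### Exponential decay of the matrix exponential of a Hurwitz matrix. -/

section MatrixExponential

open Matrix NormedSpace

variable {ι : Type*} [Fintype ι] [DecidableEq ι]

attribute [local instance] Matrix.linftyOpNormedRing Matrix.linftyOpNormedAlgebra

theorem hasDerivAt_matrix_exp (M : Matrix ι ι ℝ) (t : ℝ) :
    HasDerivAt (fun s : ℝ => exp (s • M)) (exp (t • M) * M) t :=
  hasDerivAt_exp_smul_const M t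

theorem exp_mulVec_eq_sum (N : Matrix ι ι ℂ) (v : ι → ℂ) (k : ℕ) (h : N ^ k *ᵥ v = 0) :
    exp N *ᵥ v = ∑ i ∈ Finset.range k, ((i.factorial : ℂ)⁻¹) • (N ^ i *ᵥ v) := by
  have h1 : HasSum (fun i : ℕ => ((i.factorial : ℂ)⁻¹) • N ^ i) (exp N) :=
    NormedSpace.exp_series_hasSum_exp' N
  let L : Matrix ι ι ℂ →ₗ[ℂ] (ι → ℂ) :=
    { toFun := fun X => X *ᵥ v
      map_add' := fun X Y => Matrix.add_mulVec X Y v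
      map_smul' := fun c X => Matrix.smul_mulVec c X v }
  have h2 := h1.mapL (LinearMap.toContinuousLinearMap L)
  have h3 : ∀ i ∉ Finset.range k,
      (LinearMap.toContinuousLinearMap L) (((i.factorial : ℂ)⁻¹) • N ^ i) = 0 := by
    intro i hi
    have hi : k ≤ i := by simpa using hi
    have : N ^ i *ᵥ v = 0 := by
      rw [← Nat.sub_add_cancel hi, pow_add, ← Matrix.mulVec_mulVec, h, Matrix.mulVec_zero]
    simp [L, this]
  have h4 := h2.unique (hasSum_sum_of_ne_finset_zero h3)
  simpa [L, Matrix.smul_mulVec] using h4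

/-- M splits into the commuting parts μ and M − μ. On a generalized eigenvector the exponential
series of the second part terminates. -/
theorem exp_smul_mulVec_eq_sum (M : Matrix ι ι ℂ) (μ : ℂ) (v : ι → ℂ) (k : ℕ)
    (h : (M - μ • (1 : Matrix ι ι ℂ)) ^ k *ᵥ v = 0) (t : ℂ) :
    exp (t • M) *ᵥ v = Complex.exp (t * μ) • ∑ i ∈ Finset.range k,
      (t ^ i / (i.factorial : ℂ)) • ((M - μ • (1 : Matrix ι ι ℂ)) ^ i *ᵥ v) := by
  set N := M - μ • (1 : Matrix ι ι ℂ) with hN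
  have h1 : t • M = (t * μ) • (1 : Matrix ι ι ℂ) + t • N := by
    rw [hN, smul_sub, smul_smul]; abel
  have hc : Commute ((t * μ) • (1 : Matrix ι ι ℂ)) (t • N) :=
    (Commute.one_left _).smul_left _
  have h2 : exp ((t * μ) • (1 : Matrix ι ι ℂ)) = Complex.exp (t * μ) • (1 : Matrix ι ι ℂ) := by
    rw [← Algebra.algebraMap_eq_smul_one, Complex.exp_eq_exp_ℂ, ← Algebra.algebraMap_eq_smul_one]
    exact (NormedSpace.algebraMap_exp_comm (t * μ)).symm
  have h3 : (t • N) ^ k *ᵥ v = 0 := by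
    rw [smul_pow, Matrix.smul_mulVec, h, smul_zero]
  rw [h1, Matrix.exp_add_of_commute _ _ hc, h2, ← Matrix.mulVec_mulVec,
    exp_mulVec_eq_sum _ _ _ h3, Matrix.smul_mulVec, Matrix.one_mulVec]
  congr 1
  refine Finset.sum_congr rfl fun i _ => ?_
  rw [smul_pow, Matrix.smul_mulVec, smul_smul]
  congr 1
  ring

/-- The vectors whose orbit under `exp (t M)` decays exponentially. -/
def decaySubmodule (M : Matrix ι ι ℂ) : Submodule ℂ (ι → ℂ) where
  carrier := {v | ∃ c a : ℝ, 0 < a ∧ ∀ t : ℝ, 0 ≤ t →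
    ‖exp ((t : ℂ) • M) *ᵥ v‖ ≤ c * Real.exp (-a * t)}
  zero_mem' := ⟨0, 1, one_pos, fun t _ => by simp⟩
  add_mem' := by
    rintro v w ⟨c, a, ha, h⟩ ⟨c', a', ha', h'⟩
    refine ⟨|c| + |c'|, min a a', lt_min ha ha', fun t ht => ?_⟩
    rw [Matrix.mulVec_add, add_mul]
    refine (norm_add_le _ _).trans (add_le_add ((h t ht).trans ?_) ((h' t ht).trans ?_))
    · exact mul_le_mul (le_abs_self c) (Real.exp_le_exp.2 (by nlinarith [min_le_left a a']))
        (Real.exp_pos _).le (abs_nonneg _)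
    · exact mul_le_mul (le_abs_self c') (Real.exp_le_exp.2 (by nlinarith [min_le_right a a']))
        (Real.exp_pos _).le (abs_nonneg _)
  smul_mem' := by
    rintro z v ⟨c, a, ha, h⟩
    refine ⟨‖z‖ * c, a, ha, fun t ht => ?_⟩
    rw [Matrix.mulVec_smul, norm_smul, mul_assoc]
    exact mul_le_mul_of_nonneg_left (h t ht) (norm_nonneg _)

/-- The orbit is exp(tμ) times a polynomial in t. Half of the decay rate of exp(tμ) absorbs the
polynomial, through tⁱ/i! ≤ b⁻ⁱ exp(bt) with b = −Re μ / 2. -/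
theorem mem_decaySubmodule_of_genEigenvector (M : Matrix ι ι ℂ) (μ : ℂ) (hμ : μ.re < 0)
    (v : ι → ℂ) (k : ℕ) (h : (M - μ • (1 : Matrix ι ι ℂ)) ^ k *ᵥ v = 0) :
    v ∈ decaySubmodule M := by
  set N := M - μ • (1 : Matrix ι ι ℂ) with hN
  set b : ℝ := -μ.re / 2 with hb
  have hb0 : 0 < b := by rw [hb]; linarith
  refine ⟨∑ i ∈ Finset.range k, (1 / b ^ i) * ‖N ^ i *ᵥ v‖, b, hb0, fun t ht => ?_⟩
  rw [exp_smul_mulVec_eq_sum M μ v k h, norm_smul, Complex.norm_exp]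
  have hre : ((t : ℂ) * μ).re = -(2 * b) * t := by simp [hb]; ring
  rw [hre]
  have h1 : ‖∑ i ∈ Finset.range k, ((t : ℂ) ^ i / (i.factorial : ℂ)) • (N ^ i *ᵥ v)‖ ≤
      (∑ i ∈ Finset.range k, (1 / b ^ i) * ‖N ^ i *ᵥ v‖) * Real.exp (b * t) := by
    rw [Finset.sum_mul]
    refine (norm_sum_le _ _).trans (Finset.sum_le_sum fun i _ => ?_)
    rw [norm_smul]
    have h2 : ‖(t : ℂ) ^ i / (i.factorial : ℂ)‖ = t ^ i / i.factorial := by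
      simp [abs_of_nonneg ht]
    have h3 := Real.pow_div_factorial_le_exp (b * t) (mul_nonneg hb0.le ht) i
    have h4 : t ^ i / i.factorial ≤ 1 / b ^ i * Real.exp (b * t) := by
      have : t ^ i / i.factorial = 1 / b ^ i * ((b * t) ^ i / i.factorial) := by
        rw [mul_pow]; field_simp
      rw [this]
      exact mul_le_mul_of_nonneg_left h3 (by positivity)
    rw [h2]
    calc _ ≤ (1 / b ^ i * Real.exp (b * t)) * ‖N ^ i *ᵥ v‖ :=
          mul_le_mul_of_nonneg_right h4 (norm_nonneg _)
      _ = _ := by ring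
  calc _ ≤ Real.exp (-(2 * b) * t) *
        ((∑ i ∈ Finset.range k, (1 / b ^ i) * ‖N ^ i *ᵥ v‖) * Real.exp (b * t)) :=
        mul_le_mul_of_nonneg_left h1 (Real.exp_pos _).le
    _ = (∑ i ∈ Finset.range k, (1 / b ^ i) * ‖N ^ i *ᵥ v‖) *
        (Real.exp (-(2 * b) * t) * Real.exp (b * t)) := by ring
    _ = _ := by rw [← Real.exp_add]; congr 2; ring

/-- Over ℂ the generalized eigenspaces span the space, and decaying orbits form a subspace, so no
Jordan form is needed. -/
theorem decaySubmodule_eq_top (M : Matrix ι ι ℂ) (h : ∀ z ∈ spectrum ℂ M, z.re < 0) :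
    decaySubmodule M = ⊤ := by
  rw [eq_top_iff, ← Module.End.iSup_maxGenEigenspace_eq_top (Matrix.toLin' M)]
  refine iSup_le fun μ v hv => ?_
  by_cases hv0 : v = 0
  · subst hv0; exact zero_mem _
  obtain ⟨k, hk⟩ := Module.End.mem_maxGenEigenspace _ _ _ |>.1 hv
  have hμ : Module.End.HasEigenvalue (Matrix.toLin' M) μ := by
    refine Module.End.hasEigenvalue_of_hasGenEigenvalue (k := k) fun hbot => hv0 ?_
    rw [← Submodule.mem_bot ℂ, ← hbot, Module.End.mem_genEigenspace_nat]
    exact hk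
  refine mem_decaySubmodule_of_genEigenvector M μ (h μ ?_) v k ?_
  · rw [← Matrix.spectrum_toLin']
    exact hμ.mem_spectrum
  · have : ((Matrix.toLin' M - μ • (1 : Module.End ℂ (ι → ℂ))) ^ k) =
        Matrix.toLin' ((M - μ • (1 : Matrix ι ι ℂ)) ^ k) := by
      rw [Matrix.toLin'_pow]; congr 1
      ext; simp
    rw [this, Matrix.toLin'_apply] at hk
    exact hk

theorem exp_map_ofReal (M : Matrix ι ι ℝ) (t : ℝ) :
    exp ((t : ℂ) • M.map (algebraMap ℝ ℂ)) = (exp (t • M)).map (algebraMap ℝ ℂ) := by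
  have h := NormedSpace.map_exp (f := (algebraMap ℝ ℂ).mapMatrix (m := ι))
    (by exact Continuous.matrix_map continuous_id Complex.continuous_ofReal) (t • M)
  simp only [RingHom.mapMatrix_apply] at h
  refine Eq.trans ?_ h.symm
  congr 1
  ext i j
  simp

theorem IsHurwitz.exists_exp_entry_bound {M : Matrix ι ι ℝ} (h : IsHurwitz M) :
    ∃ c a : ℝ, 0 < a ∧ 0 ≤ c ∧ ∀ t : ℝ, 0 ≤ t → ∀ i j,
      |exp (t • M) i j| ≤ c * Real.exp (-a * t) := by
  have h1 : ∀ j : ι, ∃ c a : ℝ, 0 < a ∧ ∀ t : ℝ, 0 ≤ t → ∀ i,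
      |exp (t • M) i j| ≤ c * Real.exp (-a * t) := by
    intro j
    -- The orbit of the j-th unit vector is the j-th column of the exponential.
    have hm : (Pi.single j 1 : ι → ℂ) ∈ decaySubmodule (M.map (algebraMap ℝ ℂ)) := by
      rw [decaySubmodule_eq_top _ h]; trivial
    obtain ⟨c, a, ha, hb⟩ := hm
    refine ⟨c, a, ha, fun t ht i => ?_⟩
    refine le_trans ?_ (hb t ht)
    refine le_trans ?_ (norm_le_pi_norm _ i)
    rw [exp_map_ofReal]
    simp
  choose c a ha hb using h1
  obtain ⟨a₀, ha₀, hle⟩ : ∃ a₀ : ℝ, 0 < a₀ ∧ ∀ j, a₀ ≤ a j := by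
    rcases isEmpty_or_nonempty ι with hι | hι
    · exact ⟨1, one_pos, fun j => (hι.false j).elim⟩
    · obtain ⟨j, hj⟩ := Finite.exists_min a
      exact ⟨a j, ha j, hj⟩
  refine ⟨∑ j, |c j|, a₀, ha₀, Finset.sum_nonneg fun _ _ => abs_nonneg _, fun t ht i j => ?_⟩
  refine (hb j t ht i).trans (mul_le_mul ?_ (Real.exp_le_exp.2 ?_) (Real.exp_pos _).le ?_)
  · exact (le_abs_self _).trans
      (Finset.single_le_sum (f := fun j => |c j|) (fun _ _ => abs_nonneg _) (Finset.mem_univ j))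
  · nlinarith [hle j]
  · exact Finset.sum_nonneg fun _ _ => abs_nonneg _

/-- The matrix exponential of a Hurwitz matrix decays exponentially. -/
theorem IsHurwitz.exists_exp_bound {M : Matrix ι ι ℝ} (h : IsHurwitz M) :
    ∃ c a : ℝ, 0 < a ∧ 0 ≤ c ∧ ∀ t : ℝ, 0 ≤ t → ∀ v : ι → ℝ,
      ‖exp (t • M) *ᵥ v‖ ≤ c * Real.exp (-a * t) * ‖v‖ := by
  obtain ⟨c, a, ha, hc, hb⟩ := h.exists_exp_entry_bound
  refine ⟨Fintype.card ι * c, a, ha, by positivity, fun t ht v => ?_⟩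
  refine (pi_norm_le_iff_of_nonneg (by positivity)).2 fun i => ?_
  calc ‖(exp (t • M) *ᵥ v) i‖ ≤ ∑ j, ‖exp (t • M) i j * v j‖ := norm_sum_le _ _
    _ ≤ ∑ _j : ι, c * Real.exp (-a * t) * ‖v‖ := by
        refine Finset.sum_le_sum fun j _ => ?_
        rw [norm_mul]
        exact mul_le_mul (hb t ht i j) (norm_le_pi_norm v j) (norm_nonneg _) (by positivity)
    _ = _ := by simp; ring

end MatrixExponential

/-! ### Calculus of primitives of locally integrable functions on the half-line. -/

section Primitives

open MeasureTheory Set intervalIntegral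

/-- `F` is, on `[0, ∞)`, a primitive of the locally integrable function `f`. -/
def IsPrimitive {E : Type*} [NormedAddCommGroup E] [NormedSpace ℝ E] (F f : ℝ → E) : Prop :=
  (∀ T, 0 ≤ T → IntervalIntegrable f volume 0 T) ∧ ∀ t, 0 ≤ t → F t = F 0 + ∫ s in (0 : ℝ)..t, f s

theorem uIcc_zero_subset {T : ℝ} (hT : 0 ≤ T) : uIcc 0 T ⊆ Ici (0 : ℝ) := by
  rw [uIcc_of_le hT]; exact Icc_subset_Ici_self

namespace IsPrimitive

variable {E G : Type*} [NormedAddCommGroup E] [NormedSpace ℝ E]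
  [NormedAddCommGroup G] [NormedSpace ℝ G]

theorem of_hasDerivAt [CompleteSpace E] {F f : ℝ → E} (h : ∀ t, HasDerivAt F (f t) t)
    (hf : Continuous f) : IsPrimitive F f := by
  refine ⟨fun T _ => hf.intervalIntegrable _ _, fun t _ => ?_⟩
  rw [integral_eq_sub_of_hasDerivAt (fun s _ => h s) (hf.intervalIntegrable _ _)]
  abel

theorem add {F f F' f' : ℝ → E} (h : IsPrimitive F f) (h' : IsPrimitive F' f') :
    IsPrimitive (fun t => F t + F' t) (fun t => f t + f' t) := by
  refine ⟨fun T hT => (h.1 T hT).add (h'.1 T hT), fun t ht => ?_⟩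
  simp only
  rw [integral_add (h.1 t ht) (h'.1 t ht), h.2 t ht, h'.2 t ht]
  abel

theorem sub {F f F' f' : ℝ → E} (h : IsPrimitive F f) (h' : IsPrimitive F' f') :
    IsPrimitive (fun t => F t - F' t) (fun t => f t - f' t) := by
  refine ⟨fun T hT => (h.1 T hT).sub (h'.1 T hT), fun t ht => ?_⟩
  simp only
  rw [integral_sub (h.1 t ht) (h'.1 t ht), h.2 t ht, h'.2 t ht]
  abel

theorem clm_comp [CompleteSpace E] [CompleteSpace G] {F f : ℝ → E} (h : IsPrimitive F f)
    (L : E →L[ℝ] G) :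
    IsPrimitive (fun t => L (F t)) (fun t => L (f t)) := by
  refine ⟨fun T hT => ?_, fun t ht => ?_⟩
  · have h1 := h.1 T hT
    exact ⟨L.integrable_comp h1.1, L.integrable_comp h1.2⟩
  · simp only
    rw [L.intervalIntegral_comp_comm (h.1 t ht), h.2 t ht, map_add]

theorem congr {F f F' f' : ℝ → E} (h : IsPrimitive F f) (hF : ∀ t, 0 ≤ t → F' t = F t)
    (hf : ∀ t, 0 ≤ t → f' t = f t) : IsPrimitive F' f' := by
  have hf' : ∀ T, 0 ≤ T → EqOn f f' (uIcc 0 T) := fun T hT t ht =>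
    (hf t (uIcc_zero_subset hT ht)).symm
  refine ⟨fun T hT => (h.1 T hT).congr ((hf' T hT).mono uIoc_subset_uIcc), fun t ht => ?_⟩
  rw [hF t ht, hF 0 le_rfl, h.2 t ht, integral_congr (hf' t ht)]

theorem continuousOn {F f : ℝ → E} (h : IsPrimitive F f) : ContinuousOn F (Ici 0) := by
  intro t ht
  have ht : (0 : ℝ) ≤ t := ht
  have h1 : ContinuousOn (fun s => F 0 + ∫ r in (0 : ℝ)..s, f r) (uIcc 0 (t + 1)) :=
    continuousOn_const.add (continuousOn_primitive_interval'
      (h.1 (t + 1) (by linarith)) left_mem_uIcc)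
  rw [uIcc_of_le (by linarith)] at h1
  have h2 : ContinuousOn F (Icc 0 (t + 1)) := h1.congr fun s hs => h.2 s hs.1
  exact (h2 t ⟨ht, by linarith⟩).mono_of_mem_nhdsWithin
    (mem_nhdsWithin.2 ⟨Iio (t + 1), isOpen_Iio, by simp, fun s hs => ⟨hs.2, hs.1.le⟩⟩)

theorem pi {ι : Type*} [Fintype ι] {F f : ℝ → ι → ℝ}
    (h : ∀ i, IsPrimitive (fun t => F t i) (fun t => f t i)) : IsPrimitive F f := by
  have hi : ∀ T, 0 ≤ T → IntervalIntegrable f volume 0 T := fun T hT =>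
    ⟨Integrable.of_eval fun i => ((h i).1 T hT).1, Integrable.of_eval fun i => ((h i).1 T hT).2⟩
  refine ⟨hi, fun t ht => ?_⟩
  ext i
  have h1 := (ContinuousLinearMap.proj (R := ℝ) (φ := fun _ : ι => ℝ) i).intervalIntegral_comp_comm
    (hi t ht)
  have h2 := (h i).2 t ht
  simp only [ContinuousLinearMap.proj_apply] at h1
  rw [Pi.add_apply, ← h1]
  exact h2

theorem eval {ι : Type*} [Fintype ι] {F f : ℝ → ι → ℝ} (h : IsPrimitive F f) (i : ι) :
    IsPrimitive (fun t => F t i) (fun t => f t i) :=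
  h.clm_comp (ContinuousLinearMap.proj (R := ℝ) (φ := fun _ : ι => ℝ) i)

theorem sum {ι : Type*} (s : Finset ι) {F f : ι → ℝ → E}
    (h : ∀ i ∈ s, IsPrimitive (F i) (f i)) :
    IsPrimitive (fun t => ∑ i ∈ s, F i t) (fun t => ∑ i ∈ s, f i t) := by
  classical
  induction s using Finset.induction_on with
  | empty => exact ⟨fun T _ => by simp, fun t _ => by simp⟩
  | insert a s ha ih =>
    simp only [Finset.sum_insert ha]
    exact (h a (by simp)).add (ih fun i hi => h i (by simp [hi]))

/-- Nothing is known of F on the negative axis, so two-sided derivatives are taken of the integral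
function, which agrees with F on [0, ∞). -/
theorem absolutelyContinuous {F f : ℝ → ℝ} (h : IsPrimitive F f) {T : ℝ} (hT : 0 ≤ T) :
    AbsolutelyContinuousOnInterval (fun s => F 0 + ∫ r in (0 : ℝ)..s, f r) 0 T ∧
    ∀ᵐ s, s ∈ uIcc 0 T → HasDerivAt (fun s => F 0 + ∫ r in (0 : ℝ)..s, f r) (f s) s := by
  constructor
  · exact AbsolutelyContinuousOnInterval.add
      ((LipschitzWith.const (F 0)).lipschitzOnWith (s := uIcc 0 T)).absolutelyContinuousOnInterval
      ((h.1 T hT).absolutelyContinuousOnInterval_intervalIntegral left_mem_uIcc)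
  · filter_upwards [(h.1 T hT).ae_hasDerivAt_integral] with s hs hs'
    exact (hs hs' 0 left_mem_uIcc).const_add _

/-- Integration by parts for absolutely continuous functions. The inputs are merely locally
integrable, so states need not be differentiable everywhere. -/
theorem mul {F f K k : ℝ → ℝ} (h : IsPrimitive F f) (h' : IsPrimitive K k) :
    IsPrimitive (fun t => F t * K t) (fun t => f t * K t + F t * k t) := by
  refine ⟨fun T hT => ?_, fun T hT => ?_⟩
  · exact ((h.1 T hT).mul_continuousOn (h'.continuousOn.mono (uIcc_zero_subset hT))).add
      ((h'.1 T hT).continuousOn_mul (h.continuousOn.mono (uIcc_zero_subset hT)))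
  · obtain ⟨a1, a2⟩ := h.absolutelyContinuous hT
    obtain ⟨b1, b2⟩ := h'.absolutelyContinuous hT
    have h1 := a1.integral_deriv_mul_eq_sub b1
    have h2 : ∫ s in (0 : ℝ)..T, (f s * K s + F s * k s) =
        ∫ s in (0 : ℝ)..T, (deriv (fun s => F 0 + ∫ r in (0 : ℝ)..s, f r) s *
          (K 0 + ∫ r in (0 : ℝ)..s, k r) + (F 0 + ∫ r in (0 : ℝ)..s, f r) *
          deriv (fun s => K 0 + ∫ r in (0 : ℝ)..s, k r) s) := by
      refine integral_congr_ae ?_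
      filter_upwards [a2, b2] with s ha hb hs
      have hs' : s ∈ uIcc 0 T := uIoc_subset_uIcc hs
      have hs0 : 0 ≤ s := uIcc_zero_subset hT hs'
      rw [(ha hs').deriv, (hb hs').deriv, h.2 s hs0, h'.2 s hs0]
    simp only
    rw [h2, h1, ← h.2 T hT, ← h'.2 T hT]
    simp

theorem dotProduct {ι : Type*} [Fintype ι] {F f K k : ℝ → ι → ℝ} (h : IsPrimitive F f)
    (h' : IsPrimitive K k) :
    IsPrimitive (fun t => F t ⬝ᵥ K t) (fun t => f t ⬝ᵥ K t + F t ⬝ᵥ k t) := by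
  have := IsPrimitive.sum Finset.univ fun i _ => (h.eval i).mul (h'.eval i)
  refine this.congr (fun t _ => rfl) fun t _ => ?_
  rw [Finset.sum_add_distrib]; rfl

theorem mulVec {ι κ : Type*} [Fintype ι] [Fintype κ] {F f : ℝ → ι → ℝ} (h : IsPrimitive F f)
    (M : Matrix κ ι ℝ) : IsPrimitive (fun t => M *ᵥ F t) (fun t => M *ᵥ f t) :=
  h.clm_comp (LinearMap.toContinuousLinearMap M.mulVecLin)

end IsPrimitive

theorem IsStateTraj.isPrimitive {n m : ℕ} {A : Matrix (Fin n) (Fin n) ℝ}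
    {B : Matrix (Fin n) (Fin m) ℝ} {u : ℝ → Fin m → ℝ} {x0 : Fin n → ℝ} {x : ℝ → Fin n → ℝ}
    (h : IsStateTraj A B u x0 x) : IsPrimitive x (fun t => A *ᵥ x t + B *ᵥ u t) := by
  have h0 : x 0 = x0 := by simpa using h.2.2 0 le_rfl
  refine ⟨fun T hT => IntervalIntegrable.add ?_ ?_, fun t ht => by rw [h0]; exact h.2.2 t ht⟩
  · refine ContinuousOn.intervalIntegrable ?_
    exact (Continuous.matrix_mulVec continuous_const continuous_id).comp_continuousOn
      (h.2.1.mono (uIcc_zero_subset hT))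
  · have h1 := h.1 T hT
    let L := LinearMap.toContinuousLinearMap B.mulVecLin
    exact ⟨L.integrable_comp h1.1, L.integrable_comp h1.2⟩

end Primitives

/-! ### Variation of constants with locally integrable forcing. -/

section VariationOfConstants

open Matrix NormedSpace MeasureTheory Set

variable {ι : Type*} [Fintype ι] [DecidableEq ι]

/-- Entrywise, the statement does not involve a norm on matrices, so the auxiliary norm stays inside
the proof. -/
theorem hasDerivAt_exp_entry (M : Matrix ι ι ℝ) (i j : ι) (t : ℝ) :
    HasDerivAt (fun s : ℝ => exp (s • M) i j) ((exp (t • M) * M) i j) t := by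
  let _ : NormedRing (Matrix ι ι ℝ) := Matrix.linftyOpNormedRing
  let _ : NormedAlgebra ℝ (Matrix ι ι ℝ) := Matrix.linftyOpNormedAlgebra
  let L : Matrix ι ι ℝ →ₗ[ℝ] ℝ := Matrix.entryLinearMap ℝ ℝ i j
  exact (LinearMap.toContinuousLinearMap L).hasFDerivAt.comp_hasDerivAt t
    (hasDerivAt_matrix_exp M t)

theorem continuous_matrix_exp (M : Matrix ι ι ℝ) : Continuous fun s : ℝ => exp (s • M) :=
  continuous_matrix fun i j => continuous_iff_continuousAt.2 fun t =>
    (hasDerivAt_exp_entry M i j t).continuousAt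

theorem exp_smul_mul_self_comm (M : Matrix ι ι ℝ) (t : ℝ) :
    exp (t • M) * M = M * exp (t • M) :=
  (((Commute.refl M).smul_right t).exp_right).eq.symm

theorem exp_neg_smul_mul_exp (M : Matrix ι ι ℝ) (t : ℝ) :
    exp (t • M) * exp (t • (-M)) = 1 := by
  rw [← Matrix.exp_add_of_commute]
  · simp
  · exact ((Commute.refl M).neg_right).smul_left t |>.smul_right t

theorem isPrimitive_exp_row (M : Matrix ι ι ℝ) (i : ι) :
    IsPrimitive (fun t : ℝ => exp (t • M) i) (fun t => (exp (t • M) * M) i) :=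
  IsPrimitive.of_hasDerivAt (fun t => hasDerivAt_pi.2 fun j => hasDerivAt_exp_entry M i j t)
    (continuous_pi fun j =>
      ((continuous_matrix_exp M).mul continuous_const).matrix_elem i j)

/-- The trajectory `exp (t M) v` satisfies `ẋ = M x`. -/
theorem isPrimitive_exoTraj (M : Matrix ι ι ℝ) (v : ι → ℝ) :
    IsPrimitive (exoTraj M v) (fun t => M *ᵥ exoTraj M v t) := by
  refine IsPrimitive.pi fun i => ?_
  have h := (isPrimitive_exp_row M i).dotProduct
    (IsPrimitive.of_hasDerivAt (fun t => hasDerivAt_const t v) continuous_const)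
  refine h.congr (fun t _ => rfl) fun t _ => ?_
  rw [dotProduct_zero, add_zero, exoTraj, Matrix.mulVec_mulVec, ← exp_smul_mul_self_comm]
  rfl

/-- The integrating factor exp(−tM) removes the homogeneous part. -/
theorem IsPrimitive.exp_neg_mulVec {M : Matrix ι ι ℝ} {d g : ℝ → ι → ℝ}
    (h : IsPrimitive d (fun t => M *ᵥ d t + g t)) :
    IsPrimitive (fun t => exp (t • (-M)) *ᵥ d t) (fun t => exp (t • (-M)) *ᵥ g t) := by
  refine IsPrimitive.pi fun i => ?_
  refine ((isPrimitive_exp_row (-M) i).dotProduct h).congr (fun t _ => rfl) fun t _ => ?_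
  change (exp (t • (-M)) *ᵥ g t) i = ((exp (t • (-M)) * (-M)) *ᵥ d t) i +
    (exp (t • (-M)) *ᵥ (M *ᵥ d t + g t)) i
  simp [Matrix.mulVec_add, Matrix.neg_mulVec]

/-- Variation of constants for `ẋ = M x + g` with a locally integrable `g`. -/
theorem variation_of_constants {M : Matrix ι ι ℝ} {d g : ℝ → ι → ℝ}
    (h : IsPrimitive d (fun t => M *ᵥ d t + g t)) {t : ℝ} (ht : 0 ≤ t) :
    d t = exp (t • M) *ᵥ (d 0 + ∫ s in (0 : ℝ)..t, exp (s • (-M)) *ᵥ g s) := by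
  have h2 := h.exp_neg_mulVec.2 t ht
  simp only [zero_smul, exp_zero, one_mulVec] at h2
  rw [← h2, mulVec_mulVec, exp_neg_smul_mul_exp, one_mulVec]

end VariationOfConstants

/-! ### Input-to-state estimates for Hurwitz systems. -/

section Stability

open Matrix NormedSpace MeasureTheory Set Filter

variable {ι : Type*} [Fintype ι]

theorem IsPrimitive.intervalIntegrable_forcing {M : Matrix ι ι ℝ} {d g : ℝ → ι → ℝ}
    (h : IsPrimitive d (fun t => M *ᵥ d t + g t)) {T : ℝ} (hT : 0 ≤ T) :
    IntervalIntegrable g volume 0 T := by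
  have h1 : IntervalIntegrable (fun t => M *ᵥ d t) volume 0 T :=
    ContinuousOn.intervalIntegrable ((Continuous.matrix_mulVec continuous_const
      continuous_id).comp_continuousOn (h.continuousOn.mono (uIcc_zero_subset hT)))
  simpa using (h.1 T hT).sub h1

theorem intervalIntegrable_exp_mul {f : ℝ → ℝ} {T : ℝ} (a t : ℝ)
    (h : IntervalIntegrable f volume 0 T) :
    IntervalIntegrable (fun s => Real.exp (-a * (t - s)) * f s) volume 0 T :=
  h.continuousOn_mul (by fun_prop)

variable [DecidableEq ι]

/-- A Hurwitz system with a locally integrable input is bounded by an exponentially fading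
memory of the input. -/
theorem IsHurwitz.exists_norm_le {M : Matrix ι ι ℝ} (hM : IsHurwitz M) :
    ∃ c a : ℝ, 0 < a ∧ 0 ≤ c ∧ ∀ d g : ℝ → ι → ℝ, IsPrimitive d (fun t => M *ᵥ d t + g t) →
      ∀ t, 0 ≤ t → ‖d t‖ ≤ c * Real.exp (-a * t) * ‖d 0‖ +
        c * ∫ s in (0 : ℝ)..t, Real.exp (-a * (t - s)) * ‖g s‖ := by
  obtain ⟨c, a, ha, hc, hb⟩ := hM.exists_exp_bound
  refine ⟨c, a, ha, hc, fun d g h t ht => ?_⟩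
  have hg := h.intervalIntegrable_forcing ht
  have hg' := h.exp_neg_mulVec.1 t ht
  have h1 : exp (t • M) *ᵥ (∫ s in (0 : ℝ)..t, exp (s • (-M)) *ᵥ g s) =
      ∫ s in (0 : ℝ)..t, exp ((t - s) • M) *ᵥ g s := by
    have := (LinearMap.toContinuousLinearMap (exp (t • M)).mulVecLin).intervalIntegral_comp_comm hg'
    simp only [LinearMap.coe_toContinuousLinearMap', Matrix.mulVecLin_apply] at this
    rw [← this]
    refine intervalIntegral.integral_congr fun s _ => ?_
    rw [Matrix.mulVec_mulVec, ← Matrix.exp_add_of_commute]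
    · congr 2; rw [smul_neg, sub_smul, sub_eq_add_neg]
    · exact ((Commute.refl M).neg_right).smul_left t |>.smul_right s
  rw [variation_of_constants h ht, Matrix.mulVec_add, h1]
  refine (norm_add_le _ _).trans (add_le_add (hb t ht _) ?_)
  rw [← intervalIntegral.integral_const_mul]
  refine intervalIntegral.norm_integral_le_of_norm_le ht (ae_of_all _ fun s hs => ?_)
    ((intervalIntegrable_exp_mul a t hg.norm).const_mul c)
  have := hb (t - s) (by linarith [hs.2]) (g s)
  linarith

theorem integral_exp_fading_le {a t : ℝ} (ha : 0 < a) :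
    ∫ s in (0 : ℝ)..t, Real.exp (-a * (t - s)) ≤ 1 / a := by
  have h : ∀ s ∈ uIcc 0 t, HasDerivAt (fun s => Real.exp (-a * (t - s)) / a)
      (Real.exp (-a * (t - s))) s := by
    intro s _
    have h1 : HasDerivAt (fun s => -a * (t - s)) a s := by
      have := ((hasDerivAt_id s).const_sub t).const_mul (-a)
      simpa using this
    have := h1.exp.div_const a
    rwa [mul_div_assoc, div_self ha.ne', mul_one] at this
  rw [intervalIntegral.integral_eq_sub_of_hasDerivAt h
    (Continuous.intervalIntegrable (by fun_prop) _ _)]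
  have : 0 ≤ Real.exp (-a * (t - 0)) / a := by positivity
  simp only [sub_self, mul_zero, Real.exp_zero]
  linarith

/-- A Hurwitz system bounded in terms of an energy `w` of its input. -/
theorem IsHurwitz.exists_norm_le_energy {M : Matrix ι ι ℝ} (hM : IsHurwitz M) :
    ∃ c a : ℝ, 0 < a ∧ 0 ≤ c ∧ ∀ (d g : ℝ → ι → ℝ) (w : ℝ → ℝ) (κ : ℝ),
      IsPrimitive d (fun t => M *ᵥ d t + g t) →
      (∀ T, 0 ≤ T → IntervalIntegrable w volume 0 T) → (∀ t, 0 ≤ t → ‖g t‖ ^ 2 ≤ κ * w t) →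
      ∀ η, 0 < η → ∀ t, 0 ≤ t → ‖d t‖ ≤ c * Real.exp (-a * t) * ‖d 0‖ + c * (η / a) +
        c * (κ / η) * ∫ s in (0 : ℝ)..t, Real.exp (-a * (t - s)) * w s := by
  obtain ⟨c, a, ha, hc, hb⟩ := hM.exists_norm_le
  refine ⟨c, a, ha, hc, fun d g w κ h hw hgw η hη t ht => (hb d g h t ht).trans ?_⟩
  have hg := h.intervalIntegrable_forcing ht
  have h0 : IntervalIntegrable (fun s => Real.exp (-a * (t - s)) * η) volume 0 t :=
    Continuous.intervalIntegrable (by fun_prop) _ _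
  have h1 : ∫ s in (0 : ℝ)..t, Real.exp (-a * (t - s)) * ‖g s‖ ≤
      ∫ s in (0 : ℝ)..t, (Real.exp (-a * (t - s)) * η +
        κ / η * (Real.exp (-a * (t - s)) * w s)) := by
    refine intervalIntegral.integral_mono_on ht (intervalIntegrable_exp_mul a t hg.norm)
      (h0.add ((intervalIntegrable_exp_mul a t (hw t ht)).const_mul _)) fun s hs => ?_
    -- The energy enters linearly, at the price of the constant η. Large η makes the energy
    -- coefficient small; small η makes the constant small.
    have h2 : ‖g s‖ ≤ η + κ / η * w s := by
      have h3 : κ / η * w s = κ * w s / η := by ring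
      have h4 : ‖g s‖ ^ 2 / η ≤ κ * w s / η :=
        div_le_div_of_nonneg_right (hgw s hs.1) hη.le
      have h5 : ‖g s‖ ≤ η + ‖g s‖ ^ 2 / η := by
        rw [← sub_le_iff_le_add', le_div_iff₀ hη]
        nlinarith [sq_nonneg (‖g s‖ - η), norm_nonneg (g s), mul_nonneg (norm_nonneg (g s)) hη.le]
      linarith
    have := mul_le_mul_of_nonneg_left h2 (Real.exp_pos (-a * (t - s))).le
    linarith
  rw [intervalIntegral.integral_add h0 ((intervalIntegrable_exp_mul a t (hw t ht)).const_mul _),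
    intervalIntegral.integral_mul_const, intervalIntegral.integral_const_mul] at h1
  have h2 := mul_le_mul_of_nonneg_right (integral_exp_fading_le (t := t) ha) hη.le
  have h3 := mul_le_mul_of_nonneg_left (h1.trans (add_le_add_left h2 _)) hc
  have h4 : c * (1 / a * η) = c * (η / a) := by ring
  linarith

theorem integral_mono_right {w : ℝ → ℝ} (hw : ∀ T, 0 ≤ T → IntervalIntegrable w volume 0 T)
    (hw0 : ∀ t, 0 ≤ t → 0 ≤ w t) {s t : ℝ} (hs : 0 ≤ s) (hst : s ≤ t) :
    ∫ r in (0 : ℝ)..s, w r ≤ ∫ r in (0 : ℝ)..t, w r :=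
  intervalIntegral.integral_mono_interval le_rfl hs hst
    ((ae_restrict_iff' measurableSet_Ioc).2 (ae_of_all _ fun r hr => hw0 r hr.1.le))
    (hw t (hs.trans hst))

/-- The state of a Hurwitz system grows at most like an arbitrarily small multiple of the energy. -/
theorem IsHurwitz.exists_norm_le_add_energy {M : Matrix ι ι ℝ} (hM : IsHurwitz M)
    {d g : ℝ → ι → ℝ} {w : ℝ → ℝ} {κ : ℝ} (hκ : 0 ≤ κ)
    (h : IsPrimitive d (fun t => M *ᵥ d t + g t))
    (hw : ∀ T, 0 ≤ T → IntervalIntegrable w volume 0 T) (hw0 : ∀ t, 0 ≤ t → 0 ≤ w t)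
    (hgw : ∀ t, 0 ≤ t → ‖g t‖ ^ 2 ≤ κ * w t) {δ : ℝ} (hδ : 0 < δ) :
    ∃ C₀, ∀ t, 0 ≤ t → ‖d t‖ ≤ C₀ + δ * ∫ s in (0 : ℝ)..t, w s := by
  obtain ⟨c, a, ha, hc, hb⟩ := hM.exists_norm_le_energy
  -- This η makes the energy coefficient cκ/η at most δ.
  have hη : 0 < (c * κ + 1) / δ := by positivity
  refine ⟨c * ‖d 0‖ + c * ((c * κ + 1) / δ / a), fun t ht => ?_⟩
  refine (hb d g w κ h hw hgw _ hη t ht).trans (add_le_add (add_le_add ?_ le_rfl) ?_)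
  · have : Real.exp (-a * t) ≤ 1 := Real.exp_le_one_iff.2 (by nlinarith)
    have h1 := mul_le_mul_of_nonneg_left this (mul_nonneg hc (norm_nonneg (d 0)))
    linarith
  · have h1 : ∫ s in (0 : ℝ)..t, Real.exp (-a * (t - s)) * w s ≤ ∫ s in (0 : ℝ)..t, w s := by
      refine intervalIntegral.integral_mono_on ht (intervalIntegrable_exp_mul a t (hw t ht))
        (hw t ht) fun s hs => ?_
      have : Real.exp (-a * (t - s)) ≤ 1 :=
        Real.exp_le_one_iff.2 (by nlinarith [hs.2])
      exact mul_le_of_le_one_left (hw0 s hs.1) this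
    have h2 : 0 ≤ ∫ s in (0 : ℝ)..t, w s := by
      simpa using integral_mono_right hw hw0 le_rfl ht
    have h3 : c * (κ / ((c * κ + 1) / δ)) ≤ δ := by
      have : c * (κ / ((c * κ + 1) / δ)) = δ * (c * κ / (c * κ + 1)) := by
        field_simp
      rw [this]
      refine mul_le_of_le_one_right hδ.le ((div_le_one (by positivity)).2 (by linarith))
    calc _ ≤ c * (κ / ((c * κ + 1) / δ)) * ∫ s in (0 : ℝ)..t, w s :=
          mul_le_mul_of_nonneg_left h1 (by positivity)
      _ ≤ _ := mul_le_mul_of_nonneg_right h3 h2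

theorem tendsto_exp_neg_mul {a : ℝ} (ha : 0 < a) (b : ℝ) :
    Tendsto (fun t : ℝ => Real.exp (-a * (t - b))) atTop (𝓝 0) := by
  refine Real.tendsto_exp_atBot.comp ?_
  exact (tendsto_atTop_add_const_right _ (-b) tendsto_id).const_mul_atTop_of_neg (by linarith)

/-- The fading memory of a function of finite energy vanishes. -/
theorem tendsto_fading_integral {w : ℝ → ℝ}
    (hw : ∀ T, 0 ≤ T → IntervalIntegrable w volume 0 T) (hw0 : ∀ t, 0 ≤ t → 0 ≤ w t)
    {L : ℝ} (hL : Tendsto (fun t => ∫ s in (0 : ℝ)..t, w s) atTop (𝓝 L)) {a : ℝ} (ha : 0 < a) :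
    Tendsto (fun t => ∫ s in (0 : ℝ)..t, Real.exp (-a * (t - s)) * w s) atTop (𝓝 0) := by
  have hWL : ∀ t, 0 ≤ t → ∫ s in (0 : ℝ)..t, w s ≤ L := fun t ht =>
    ge_of_tendsto hL ((eventually_ge_atTop t).mono fun s hs => integral_mono_right hw hw0 ht hs)
  rw [Metric.tendsto_atTop]
  intro e he
  obtain ⟨s₀, hs₀⟩ := (Metric.tendsto_atTop.1 hL) (e / 2) (by linarith)
  -- Split at s: the energy after s is below e/2, and the fixed energy before s is damped by
  -- exp(−a(t − s)).
  set s := max s₀ 0 with hs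
  have hs0 : 0 ≤ s := le_max_right _ _
  have hLs : L - ∫ r in (0 : ℝ)..s, w r < e / 2 := by
    have := hs₀ s (le_max_left _ _)
    rw [Real.dist_eq, abs_lt] at this
    linarith [this.1]
  have h1 : Tendsto (fun t => Real.exp (-a * (t - s)) * ∫ r in (0 : ℝ)..s, w r) atTop (𝓝 0) := by
    simpa using (tendsto_exp_neg_mul ha s).mul_const (∫ r in (0 : ℝ)..s, w r)
  obtain ⟨t₁, ht₁⟩ := (Metric.tendsto_atTop.1 h1) (e / 2) (by linarith)
  refine ⟨max t₁ s, fun t ht => ?_⟩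
  have hts : s ≤ t := (le_max_right _ _).trans ht
  have ht0 : 0 ≤ t := hs0.trans hts
  have hi := intervalIntegrable_exp_mul a t (hw t ht0)
  have hsub1 : uIcc 0 s ⊆ uIcc 0 t := by
    rw [uIcc_of_le hs0, uIcc_of_le ht0]; exact Icc_subset_Icc_right hts
  have hsub2 : uIcc s t ⊆ uIcc 0 t := by
    rw [uIcc_of_le hts, uIcc_of_le ht0]; exact Icc_subset_Icc_left hs0
  have hnn : 0 ≤ ∫ r in (0 : ℝ)..t, Real.exp (-a * (t - r)) * w r :=
    intervalIntegral.integral_nonneg ht0 fun r hr => mul_nonneg (Real.exp_pos _).le (hw0 r hr.1)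
  rw [Real.dist_eq, sub_zero, abs_of_nonneg hnn,
    ← intervalIntegral.integral_add_adjacent_intervals (hi.mono_set hsub1) (hi.mono_set hsub2)]
  have h2 : ∫ r in (0 : ℝ)..s, Real.exp (-a * (t - r)) * w r ≤
      Real.exp (-a * (t - s)) * ∫ r in (0 : ℝ)..s, w r := by
    rw [← intervalIntegral.integral_const_mul]
    refine intervalIntegral.integral_mono_on hs0 (hi.mono_set hsub1) ((hw s hs0).const_mul _)
      fun r hr => mul_le_mul_of_nonneg_right (Real.exp_le_exp.2 ?_) (hw0 r hr.1)
    nlinarith [hr.2]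
  have h3 : ∫ r in s..t, Real.exp (-a * (t - r)) * w r ≤ ∫ r in s..t, w r := by
    refine intervalIntegral.integral_mono_on hts (hi.mono_set hsub2)
      ((hw t ht0).mono_set hsub2) fun r hr => ?_
    exact mul_le_of_le_one_left (hw0 r (hs0.trans hr.1))
      (Real.exp_le_one_iff.2 (by nlinarith [hr.2]))
  have h4 := intervalIntegral.integral_add_adjacent_intervals (hw s hs0)
    ((hw t ht0).mono_set hsub2)
  have h5 := ht₁ t ((le_max_left _ _).trans ht)
  rw [Real.dist_eq, sub_zero, abs_lt] at h5
  linarith [hWL t ht0, h5.2]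

/-- The state of a Hurwitz system with an input of finite energy converges to zero. -/
theorem IsHurwitz.tendsto_zero_of_energy {M : Matrix ι ι ℝ} (hM : IsHurwitz M)
    {d g : ℝ → ι → ℝ} {w : ℝ → ℝ} {κ : ℝ}
    (h : IsPrimitive d (fun t => M *ᵥ d t + g t))
    (hw : ∀ T, 0 ≤ T → IntervalIntegrable w volume 0 T) (hw0 : ∀ t, 0 ≤ t → 0 ≤ w t)
    (hgw : ∀ t, 0 ≤ t → ‖g t‖ ^ 2 ≤ κ * w t)
    {L : ℝ} (hL : Tendsto (fun t => ∫ s in (0 : ℝ)..t, w s) atTop (𝓝 L)) :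
    Tendsto d atTop (𝓝 0) := by
  obtain ⟨c, a, ha, hc, hb⟩ := hM.exists_norm_le_energy
  have hF := tendsto_fading_integral hw hw0 hL ha
  rw [tendsto_zero_iff_norm_tendsto_zero, Metric.tendsto_atTop]
  intro e he
  set η : ℝ := e * a / (2 * (c + 1)) with hη
  have hη0 : 0 < η := by positivity
  have hcη : c * (η / a) ≤ e / 2 := by
    have : c * (η / a) = e / 2 * (c / (c + 1)) := by rw [hη]; field_simp
    rw [this]
    exact mul_le_of_le_one_right (by linarith) ((div_le_one (by positivity)).2 (by linarith))
  have hT : Tendsto (fun t => c * Real.exp (-a * t) * ‖d 0‖ +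
      c * (κ / η) * ∫ s in (0 : ℝ)..t, Real.exp (-a * (t - s)) * w s) atTop (𝓝 0) := by
    have h1 := ((tendsto_exp_neg_mul ha 0).const_mul c).mul_const ‖d 0‖
    have h2 := hF.const_mul (c * (κ / η))
    simpa using h1.add h2
  obtain ⟨t₁, ht₁⟩ := (Metric.tendsto_atTop.1 hT) (e / 2) (by linarith)
  refine ⟨max t₁ 0, fun t ht => ?_⟩
  have h1 := hb d g w κ h hw hgw η hη0 t ((le_max_right _ _).trans ht)
  have h2 := ht₁ t ((le_max_left _ _).trans ht)
  rw [Real.dist_eq, sub_zero, abs_lt] at h2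
  rw [Real.dist_eq, sub_zero, abs_of_nonneg (norm_nonneg _)]
  linarith [h2.2]

/-- The state of a Hurwitz system with an exponentially decaying input decays exponentially. -/
theorem IsHurwitz.exists_exp_decay {M : Matrix ι ι ℝ} (hM : IsHurwitz M)
    {d g : ℝ → ι → ℝ} (h : IsPrimitive d (fun t => M *ᵥ d t + g t)) {b β : ℝ} (hβ : 0 < β)
    (hg : ∀ t, 0 ≤ t → ‖g t‖ ≤ b * Real.exp (-β * t)) :
    ∃ c γ : ℝ, 0 < γ ∧ γ ≤ β ∧ 0 ≤ c ∧ ∀ t, 0 ≤ t → ‖d t‖ ≤ c * Real.exp (-γ * t) := by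
  obtain ⟨c, a, ha, hc, hb⟩ := hM.exists_norm_le
  have hb0 : 0 ≤ b := by
    have := (norm_nonneg _).trans (hg 0 le_rfl)
    simpa using this
  -- Halving the smaller rate covers the resonant case a = β: the convolution is at most b t
  -- exp(−2γt), and one factor exp(−γt) absorbs t.
  set γ : ℝ := min a β / 2 with hγ
  have hγ0 : 0 < γ := by
    have := lt_min ha hβ
    rw [hγ]; linarith
  have hγa : 2 * γ ≤ a := by rw [hγ]; linarith [min_le_left a β]
  have hγβ : 2 * γ ≤ β := by rw [hγ]; linarith [min_le_right a β]
  refine ⟨c * ‖d 0‖ + c * (b / γ), γ, hγ0, by linarith, by positivity, fun t ht => ?_⟩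
  refine (hb d g h t ht).trans ?_
  rw [add_mul]
  refine add_le_add ?_ ?_
  · have : Real.exp (-a * t) ≤ Real.exp (-γ * t) := Real.exp_le_exp.2 (by nlinarith)
    have := mul_le_mul_of_nonneg_left this (mul_nonneg hc (norm_nonneg (d 0)))
    linarith
  · have h1 : ∫ s in (0 : ℝ)..t, Real.exp (-a * (t - s)) * ‖g s‖ ≤
        ∫ _s in (0 : ℝ)..t, b * Real.exp (-(2 * γ) * t) := by
      refine intervalIntegral.integral_mono_on ht
        (intervalIntegrable_exp_mul a t (h.intervalIntegrable_forcing ht).norm)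
        (by simp) fun s hs => ?_
      calc _ ≤ Real.exp (-a * (t - s)) * (b * Real.exp (-β * s)) :=
            mul_le_mul_of_nonneg_left (hg s hs.1) (Real.exp_pos _).le
        _ = b * Real.exp (-a * (t - s) + -β * s) := by rw [Real.exp_add]; ring
        _ ≤ _ := mul_le_mul_of_nonneg_left (Real.exp_le_exp.2
          (by nlinarith [mul_nonneg (sub_nonneg.2 hγa) (sub_nonneg.2 hs.2),
            mul_nonneg (sub_nonneg.2 hγβ) hs.1])) hb0
    rw [intervalIntegral.integral_const, sub_zero, smul_eq_mul] at h1
    have h2 : t * Real.exp (-(2 * γ) * t) ≤ 1 / γ * Real.exp (-γ * t) := by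
      have h3 : γ * t ≤ Real.exp (γ * t) := by linarith [Real.add_one_le_exp (γ * t)]
      have h4 : Real.exp (-γ * t) = Real.exp (γ * t) * Real.exp (-(2 * γ) * t) := by
        rw [← Real.exp_add]; congr 1; ring
      rw [h4, ← mul_assoc]
      refine mul_le_mul_of_nonneg_right ?_ (Real.exp_pos _).le
      rw [one_div, ← div_eq_inv_mul, le_div_iff₀ hγ0]
      linarith
    calc _ ≤ c * (t * (b * Real.exp (-(2 * γ) * t))) := mul_le_mul_of_nonneg_left h1 hc
      _ = c * b * (t * Real.exp (-(2 * γ) * t)) := by ring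
      _ ≤ c * b * (1 / γ * Real.exp (-γ * t)) := mul_le_mul_of_nonneg_left h2 (by positivity)
      _ = _ := by ring

end Stability

/-! ### Bounds for quadratic forms in the supremum norm. -/

section QuadraticForms

open Matrix

variable {ι κ : Type*} [Fintype ι] [Fintype κ]

theorem exists_norm_mulVec_le (M : Matrix κ ι ℝ) :
    ∃ k : ℝ, 0 ≤ k ∧ ∀ v : ι → ℝ, ‖M *ᵥ v‖ ≤ k * ‖v‖ :=
  ⟨‖LinearMap.toContinuousLinearMap M.mulVecLin‖, norm_nonneg _,
    fun v => (LinearMap.toContinuousLinearMap M.mulVecLin).le_opNorm v⟩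

theorem abs_dotProduct_le (v w : ι → ℝ) : |v ⬝ᵥ w| ≤ Fintype.card ι * ‖v‖ * ‖w‖ := by
  refine (Finset.abs_sum_le_sum_abs _ _).trans ?_
  calc ∑ i, |v i * w i| ≤ ∑ _i : ι, ‖v‖ * ‖w‖ := Finset.sum_le_sum fun i _ => by
        rw [abs_mul]
        exact mul_le_mul (norm_le_pi_norm v i) (norm_le_pi_norm w i) (abs_nonneg _) (norm_nonneg _)
    _ = _ := by simp [mul_assoc]

theorem dotProduct_mulVec_comm_of_isSymm {Q : Matrix ι ι ℝ} (hQ : Qᵀ = Q) (v w : ι → ℝ) :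
    v ⬝ᵥ (Q *ᵥ w) = w ⬝ᵥ (Q *ᵥ v) := by
  conv_lhs => rw [← hQ]
  rw [dotProduct_transpose_mulVec]

theorem _root_.Matrix.PosDef.transpose_eq {ν : Type*} {Q : Matrix ν ν ℝ} (hQ : Q.PosDef) : Qᵀ = Q := by
  rw [← conjTranspose_eq_transpose_of_trivial]; exact hQ.isHermitian

theorem _root_.Matrix.PosDef.dotProduct_nonneg {Q : Matrix ι ι ℝ} (hQ : Q.PosDef) (v : ι → ℝ) :
    0 ≤ v ⬝ᵥ (Q *ᵥ v) := by
  simpa using hQ.posSemidef.dotProduct_mulVec_nonneg v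

theorem _root_.Matrix.PosDef.exists_mul_norm_sq_le {Q : Matrix ι ι ℝ} (hQ : Q.PosDef) :
    ∃ q : ℝ, 0 < q ∧ ∀ v : ι → ℝ, q * ‖v‖ ^ 2 ≤ v ⬝ᵥ (Q *ᵥ v) := by
  -- The sphere is empty only in dimension zero; otherwise q is the minimum of the form on this
  -- compact set, and homogeneity does the rest.
  rcases (Metric.sphere (0 : ι → ℝ) 1).eq_empty_or_nonempty with he | hne
  · refine ⟨1, one_pos, fun v => ?_⟩
    have hv : v = 0 := by
      by_contra hv
      have : (‖v‖⁻¹ • v) ∈ Metric.sphere (0 : ι → ℝ) 1 := by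
        simp [norm_smul, hv]
      simp [he] at this
    simp [hv]
  · have hc : Continuous fun v : ι → ℝ => v ⬝ᵥ (Q *ᵥ v) :=
      continuous_id.dotProduct (continuous_const.matrix_mulVec continuous_id)
    obtain ⟨v₀, hv₀, hmin⟩ := (isCompact_sphere (0 : ι → ℝ) 1).exists_isMinOn hne hc.continuousOn
    have hv₀0 : v₀ ≠ 0 := by
      rintro rfl
      simp at hv₀
    refine ⟨v₀ ⬝ᵥ (Q *ᵥ v₀), by simpa using hQ.dotProduct_mulVec_pos hv₀0, fun v => ?_⟩
    by_cases hv : v = 0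
    · simp [hv]
    have hn : 0 < ‖v‖ := norm_pos_iff.2 hv
    have h1 : (‖v‖⁻¹ • v) ∈ Metric.sphere (0 : ι → ℝ) 1 := by
      simp [norm_smul, hv]
    have h2 := hmin h1
    simp only [Set.mem_ofPred_eq, mulVec_smul, dotProduct_smul, smul_dotProduct, smul_eq_mul] at h2
    have h3 := mul_le_mul_of_nonneg_right h2 (sq_nonneg ‖v‖)
    have h4 : ‖v‖⁻¹ * (‖v‖⁻¹ * v ⬝ᵥ (Q *ᵥ v)) * ‖v‖ ^ 2 = v ⬝ᵥ (Q *ᵥ v) := by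
      field_simp
    rwa [h4] at h3

theorem exists_dotProduct_mulVec_le (Q : Matrix ι ι ℝ) :
    ∃ q : ℝ, 0 ≤ q ∧ ∀ v : ι → ℝ, v ⬝ᵥ (Q *ᵥ v) ≤ q * ‖v‖ ^ 2 := by
  obtain ⟨k, hk, hb⟩ := exists_norm_mulVec_le Q
  refine ⟨Fintype.card ι * k, by positivity, fun v => ?_⟩
  have h1 := (le_abs_self _).trans (abs_dotProduct_le v (Q *ᵥ v))
  have h2 := mul_le_mul_of_nonneg_left (hb v)
    (mul_nonneg (Nat.cast_nonneg (Fintype.card ι)) (norm_nonneg v))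
  calc _ ≤ _ := h1.trans h2
    _ = _ := by ring

end QuadraticForms

/-! ### The extended-valued cost as an ordinary integral, or as infinity. -/

section Cost

open Matrix MeasureTheory Set Filter

variable {m p : ℕ}

/-- The integrand of the quadratic cost. -/
def stageCost (Q : Matrix (Fin p) (Fin p) ℝ) (R : Matrix (Fin m) (Fin m) ℝ)
    (e : ℝ → Fin p → ℝ) (u : ℝ → Fin m → ℝ) (t : ℝ) : ℝ :=
  e t ⬝ᵥ (Q *ᵥ e t) + u t ⬝ᵥ (R *ᵥ u t)

variable {Q : Matrix (Fin p) (Fin p) ℝ} {R : Matrix (Fin m) (Fin m) ℝ}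
  {e : ℝ → Fin p → ℝ} {u : ℝ → Fin m → ℝ}

theorem stageCost_nonneg (hQ : Q.PosDef) (hR : R.PosDef) (t : ℝ) : 0 ≤ stageCost Q R e u t :=
  add_nonneg (hQ.dotProduct_nonneg _) (hR.dotProduct_nonneg _)

theorem cost_eq_coe (hQ : Q.PosDef) (hR : R.PosDef) {T : ℝ} (hT : 0 ≤ T)
    (h : IntervalIntegrable (stageCost Q R e u) volume 0 T) :
    ((cost Q R e u T : ℝ≥0∞) : EReal) = ((2⁻¹ * ∫ t in (0 : ℝ)..T, stageCost Q R e u t : ℝ) :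
      EReal) := by
  have h1 : IntegrableOn (stageCost Q R e u) (Icc 0 T) :=
    (intervalIntegrable_iff_integrableOn_Icc_of_le hT).1 h
  have h2 : ∫⁻ t in Icc 0 T, ENNReal.ofReal (stageCost Q R e u t) =
      ENNReal.ofReal (∫ t in (0 : ℝ)..T, stageCost Q R e u t) := by
    rw [intervalIntegral.integral_of_le hT, ← integral_Icc_eq_integral_Ioc]
    exact (ofReal_integral_eq_lintegral_ofReal h1
      (ae_of_all _ fun t => stageCost_nonneg hQ hR t)).symm
  have h3 : 0 ≤ ∫ t in (0 : ℝ)..T, stageCost Q R e u t :=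
    intervalIntegral.integral_nonneg hT fun t _ => stageCost_nonneg hQ hR t
  have h4 : cost Q R e u T = ENNReal.ofReal (2⁻¹ * ∫ t in (0 : ℝ)..T, stageCost Q R e u t) := by
    rw [ENNReal.ofReal_mul (by norm_num), ← h2, ENNReal.ofReal_inv_of_pos (by norm_num)]
    simp [cost, stageCost]
  rw [h4, EReal.coe_ennreal_ofReal, max_eq_left (by positivity)]

/-- A locally integrable control need not be square integrable. Once the cost is infinite it stays
so, since the integrand is nonnegative. -/
theorem cost_eq_top (hQ : Q.PosDef) (hR : R.PosDef) {S T : ℝ} (hS : 0 ≤ S) (hST : S ≤ T)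
    (he : ContinuousOn e (Ici 0)) (hu : IntervalIntegrable u volume 0 S)
    (h : ¬ IntervalIntegrable (stageCost Q R e u) volume 0 S) : cost Q R e u T = ⊤ := by
  rw [intervalIntegrable_iff_integrableOn_Ioc_of_le hS] at h hu
  have he' : AEStronglyMeasurable e (volume.restrict (Ioc 0 S)) :=
    (he.mono fun t ht => ht.1.le).aestronglyMeasurable measurableSet_Ioc
  have hq : ∀ {k : ℕ} (M : Matrix (Fin k) (Fin k) ℝ), Continuous fun v : Fin k → ℝ =>
      v ⬝ᵥ (M *ᵥ v) := fun M =>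
    continuous_id.dotProduct (continuous_const.matrix_mulVec continuous_id)
  have hm : AEStronglyMeasurable (stageCost Q R e u) (volume.restrict (Ioc 0 S)) :=
    ((hq Q).comp_aestronglyMeasurable he').add
      ((hq R).comp_aestronglyMeasurable hu.aestronglyMeasurable)
  have h1 : ∫⁻ t in Ioc 0 S, ENNReal.ofReal (stageCost Q R e u t) = ⊤ := by
    by_contra hne
    exact h ((lintegral_ofReal_ne_top_iff_integrable hm
      (ae_of_all _ fun t => stageCost_nonneg hQ hR t)).1 hne)
  have h2 : ∫⁻ t in Icc 0 T, ENNReal.ofReal (stageCost Q R e u t) = ⊤ := by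
    rw [eq_top_iff, ← h1]
    exact lintegral_mono_set fun t ht => ⟨ht.1.le, ht.2.trans hST⟩
  have h3 : cost Q R e u T = 2⁻¹ * ∫⁻ t in Icc 0 T, ENNReal.ofReal (stageCost Q R e u t) := rfl
  rw [h3, h2]
  simp

end Cost

/-! ### The costate identity for the bilinear part of the cost. -/

section Costate

open Matrix MeasureTheory Set Filter

variable {n m p : ℕ} {ι : Type*} [Fintype ι]
  {A : Matrix (Fin n) (Fin n) ℝ} {B : Matrix (Fin n) (Fin m) ℝ} {C : Matrix (Fin p) (Fin n) ℝ}
  {Abar : Matrix ι ι ℝ} {E : Matrix (Fin p) ι ℝ}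
  {Q : Matrix (Fin p) (Fin p) ℝ} {R : Matrix (Fin m) (Fin m) ℝ}
  {Pi : Matrix (Fin n) ι ℝ} {Gam : Matrix (Fin m) ι ℝ} {PiLam : Matrix (Fin n) ι ℝ}

/-- The bilinear part of the cost along the stationary trajectory. -/
def crossTerm (C : Matrix (Fin p) (Fin n) ℝ) (Q : Matrix (Fin p) (Fin p) ℝ)
    (R : Matrix (Fin m) (Fin m) ℝ) (E : Matrix (Fin p) ι ℝ) (Gam : Matrix (Fin m) ι ℝ)
    (d : Fin n → ℝ) (v : Fin m → ℝ) (xbar : ι → ℝ) : ℝ :=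
  d ⬝ᵥ ((Cᵀ * Q * E) *ᵥ xbar) + v ⬝ᵥ ((R * Gam) *ᵥ xbar)

theorem stageCost_eq_add_crossTerm (hQ : Qᵀ = Q) (hR : Rᵀ = R) (d : ℝ → Fin n → ℝ)
    (v : ℝ → Fin m → ℝ) (xbar : ℝ → ι → ℝ) (t : ℝ) :
    stageCost Q R (fun t => C *ᵥ d t + E *ᵥ xbar t) (fun t => v t + Gam *ᵥ xbar t) t =
      stageCost Q R (fun t => E *ᵥ xbar t) (fun t => Gam *ᵥ xbar t) t +
      stageCost Q R (fun t => C *ᵥ d t) v t + 2 * crossTerm C Q R E Gam (d t) (v t) (xbar t) := by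
  have h1 : d t ⬝ᵥ ((Cᵀ * Q * E) *ᵥ xbar t) = (C *ᵥ d t) ⬝ᵥ (Q *ᵥ (E *ᵥ xbar t)) := by
    rw [← mulVec_mulVec, ← mulVec_mulVec, dotProduct_transpose_mulVec, dotProduct_comm]
  have h2 : v t ⬝ᵥ ((R * Gam) *ᵥ xbar t) = v t ⬝ᵥ (R *ᵥ (Gam *ᵥ xbar t)) := by
    rw [← mulVec_mulVec]
  simp only [stageCost, crossTerm, h1, h2, mulVec_add, dotProduct_add, add_dotProduct]
  rw [dotProduct_mulVec_comm_of_isSymm hQ (E *ᵥ xbar t) (C *ᵥ d t),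
    dotProduct_mulVec_comm_of_isSymm hR (Gam *ᵥ xbar t) (v t)]
  ring

/-- The costate equations turn the bilinear part of the cost into a boundary term. -/
theorem isPrimitive_costate (hL : PiLam * Abar = -(Aᵀ * PiLam) - Cᵀ * Q * E)
    (hG : R * Gam = -(Bᵀ * PiLam)) {xbar : ℝ → ι → ℝ}
    (hxbar : IsPrimitive xbar (fun t => Abar *ᵥ xbar t)) {d : ℝ → Fin n → ℝ}
    {v : ℝ → Fin m → ℝ} (hd : IsPrimitive d (fun t => A *ᵥ d t + B *ᵥ v t)) :
    IsPrimitive (fun t => (PiLam *ᵥ xbar t) ⬝ᵥ d t)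
      (fun t => -crossTerm C Q R E Gam (d t) (v t) (xbar t)) := by
  refine ((hxbar.mulVec PiLam).dotProduct hd).congr (fun t _ => rfl) fun t _ => ?_
  simp only [crossTerm]
  rw [mulVec_mulVec, hL, hG, sub_mulVec, neg_mulVec, neg_mulVec, sub_dotProduct, neg_dotProduct,
    dotProduct_neg, dotProduct_add, ← mulVec_mulVec _ Aᵀ, ← mulVec_mulVec _ Bᵀ,
    dotProduct_transpose_mulVec, dotProduct_comm (Aᵀ *ᵥ _), dotProduct_transpose_mulVec,
    dotProduct_comm ((Cᵀ * Q * E) *ᵥ _)]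
  ring

end Costate

/-! ### Optimal stationary synchronization from the Hamiltonian equations. -/

section OptimalSynchronization

open Matrix MeasureTheory Set Filter

variable {n m p : ℕ} {ι : Type*} [Fintype ι]
  {A : Matrix (Fin n) (Fin n) ℝ} {B : Matrix (Fin n) (Fin m) ℝ} {C : Matrix (Fin p) (Fin n) ℝ}
  {Abar : Matrix ι ι ℝ} {Cbar : Matrix (Fin p) ι ℝ}
  {Q : Matrix (Fin p) (Fin p) ℝ} {R : Matrix (Fin m) (Fin m) ℝ}
  {Pi : Matrix (Fin n) ι ℝ} {Gam : Matrix (Fin m) ι ℝ} {PiLam : Matrix (Fin n) ι ℝ}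

/-- With output injection, ḋ = (A − LC)d + (LCd + Bv). Definiteness of Q and R lets the stage cost
control this forcing, although it does not control d itself. -/
theorem exists_injection_norm_sq_le (B : Matrix (Fin n) (Fin m) ℝ) (C : Matrix (Fin p) (Fin n) ℝ)
    (L : Matrix (Fin n) (Fin p) ℝ) (hQ : Q.PosDef) (hR : R.PosDef) :
    ∃ κ : ℝ, 0 ≤ κ ∧ ∀ (d : ℝ → Fin n → ℝ) (v : ℝ → Fin m → ℝ) (t : ℝ),
      ‖L *ᵥ (C *ᵥ d t) + B *ᵥ v t‖ ^ 2 ≤ κ * stageCost Q R (fun t => C *ᵥ d t) v t := by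
  obtain ⟨q, hq, hqb⟩ := hQ.exists_mul_norm_sq_le
  obtain ⟨r, hr, hrb⟩ := hR.exists_mul_norm_sq_le
  obtain ⟨l, hl, hlb⟩ := exists_norm_mulVec_le L
  obtain ⟨b, hb, hbb⟩ := exists_norm_mulVec_le B
  refine ⟨2 * l ^ 2 / q + 2 * b ^ 2 / r, by positivity, fun d v t => ?_⟩
  have h1 : ‖L *ᵥ (C *ᵥ d t) + B *ᵥ v t‖ ≤ l * ‖C *ᵥ d t‖ + b * ‖v t‖ :=
    (norm_add_le _ _).trans (add_le_add (hlb _) (hbb _))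
  have h2 : ‖L *ᵥ (C *ᵥ d t) + B *ᵥ v t‖ ^ 2 ≤
      2 * l ^ 2 * ‖C *ᵥ d t‖ ^ 2 + 2 * b ^ 2 * ‖v t‖ ^ 2 := by
    refine (pow_le_pow_left₀ (norm_nonneg _) h1 2).trans ?_
    nlinarith [sq_nonneg (l * ‖C *ᵥ d t‖ - b * ‖v t‖)]
  have h3 : ‖C *ᵥ d t‖ ^ 2 ≤ stageCost Q R (fun t => C *ᵥ d t) v t / q := by
    rw [le_div_iff₀ hq, mul_comm]
    exact (hqb _).trans (le_add_of_nonneg_right (hR.dotProduct_nonneg _))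
  have h4 : ‖v t‖ ^ 2 ≤ stageCost Q R (fun t => C *ᵥ d t) v t / r := by
    rw [le_div_iff₀ hr, mul_comm]
    exact (hrb _).trans (le_add_of_nonneg_left (hQ.dotProduct_nonneg _))
  calc _ ≤ _ := h2
    _ ≤ 2 * l ^ 2 * (stageCost Q R (fun t => C *ᵥ d t) v t / q) +
        2 * b ^ 2 * (stageCost Q R (fun t => C *ᵥ d t) v t / r) :=
      add_le_add (mul_le_mul_of_nonneg_left h3 (by positivity))
        (mul_le_mul_of_nonneg_left h4 (by positivity))
    _ = _ := by ring

/-- The deviation of a state trajectory from the stationary trajectory. -/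
theorem isPrimitive_deviation (hPi : Pi * Abar = A * Pi + B * Gam) {xbar : ℝ → ι → ℝ}
    (hxbar : IsPrimitive xbar (fun t => Abar *ᵥ xbar t)) {x : ℝ → Fin n → ℝ} {u : ℝ → Fin m → ℝ}
    (hx : IsPrimitive x (fun t => A *ᵥ x t + B *ᵥ u t)) :
    IsPrimitive (fun t => x t - Pi *ᵥ xbar t)
      (fun t => A *ᵥ (x t - Pi *ᵥ xbar t) + B *ᵥ (u t - Gam *ᵥ xbar t)) := by
  refine (hx.sub (hxbar.mulVec Pi)).congr (fun t _ => rfl) fun t _ => ?_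
  rw [mulVec_mulVec, hPi, add_mulVec, mulVec_sub, mulVec_sub, ← mulVec_mulVec, ← mulVec_mulVec]
  abel

variable {E : Matrix (Fin p) ι ℝ}

theorem continuousOn_stageCost {e : ℝ → Fin p → ℝ} {u : ℝ → Fin m → ℝ} {s : Set ℝ}
    (he : ContinuousOn e s) (hu : ContinuousOn u s) : ContinuousOn (stageCost Q R e u) s := by
  have hq : ∀ {k : ℕ} (M : Matrix (Fin k) (Fin k) ℝ), Continuous fun v : Fin k → ℝ =>
      v ⬝ᵥ (M *ᵥ v) := fun M =>
    continuous_id.dotProduct (continuous_const.matrix_mulVec continuous_id)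
  exact ((hq Q).comp_continuousOn he).add ((hq R).comp_continuousOn hu)

theorem continuousOn_mulVec {κ κ' : Type*} [Fintype κ] [Fintype κ'] (M : Matrix κ' κ ℝ)
    {f : ℝ → κ → ℝ} {s : Set ℝ} (hf : ContinuousOn f s) : ContinuousOn (fun t => M *ᵥ f t) s :=
  (Continuous.matrix_mulVec continuous_const continuous_id).comp_continuousOn hf

/-- The cost integral splits into a term independent of the control, a boundary term, and the
energy of the deviation. -/
theorem integral_stageCost_eq (hQ : Qᵀ = Q) (hR : Rᵀ = R)
    (hL : PiLam * Abar = -(Aᵀ * PiLam) - Cᵀ * Q * E)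
    (hG : R * Gam = -(Bᵀ * PiLam)) {xbar : ℝ → ι → ℝ}
    (hxbar : IsPrimitive xbar (fun t => Abar *ᵥ xbar t)) {d : ℝ → Fin n → ℝ}
    {v : ℝ → Fin m → ℝ} (hd : IsPrimitive d (fun t => A *ᵥ d t + B *ᵥ v t))
    (hint : ∀ T, 0 ≤ T → IntervalIntegrable (stageCost Q R (fun t => C *ᵥ d t + E *ᵥ xbar t)
      (fun t => v t + Gam *ᵥ xbar t)) volume 0 T) :
    (∀ T, 0 ≤ T → IntervalIntegrable (stageCost Q R (fun t => C *ᵥ d t) v) volume 0 T) ∧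
    ∀ T, 0 ≤ T → ∫ t in (0 : ℝ)..T, stageCost Q R (fun t => C *ᵥ d t + E *ᵥ xbar t)
        (fun t => v t + Gam *ᵥ xbar t) t =
      (∫ t in (0 : ℝ)..T, stageCost Q R (fun t => E *ᵥ xbar t) (fun t => Gam *ᵥ xbar t) t) +
      (∫ t in (0 : ℝ)..T, stageCost Q R (fun t => C *ᵥ d t) v t) +
      2 * ((PiLam *ᵥ xbar 0) ⬝ᵥ d 0 - (PiLam *ᵥ xbar T) ⬝ᵥ d T) := by
  have hc := isPrimitive_costate hL hG hxbar hd
  have hcross : ∀ T, 0 ≤ T → IntervalIntegrable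
      (fun t => crossTerm C Q R E Gam (d t) (v t) (xbar t)) volume 0 T := fun T hT =>
    (hc.1 T hT).neg.congr fun t _ => neg_neg _
  have hbase : ∀ T, 0 ≤ T → IntervalIntegrable
      (stageCost Q R (fun t => E *ᵥ xbar t) (fun t => Gam *ᵥ xbar t)) volume 0 T := fun T hT =>
    ((continuousOn_stageCost (continuousOn_mulVec E hxbar.continuousOn)
      (continuousOn_mulVec Gam hxbar.continuousOn)).mono (uIcc_zero_subset hT)).intervalIntegrable
  -- Integrability of the deviation energy is obtained by subtraction, since v is not assumed square
  -- integrable.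
  have hw : ∀ T, 0 ≤ T → IntervalIntegrable (stageCost Q R (fun t => C *ᵥ d t) v) volume 0 T := by
    intro T hT
    refine (((hint T hT).sub (hbase T hT)).sub ((hcross T hT).const_mul 2)).congr ?_
    intro t _
    simp only
    rw [stageCost_eq_add_crossTerm hQ hR]
    ring
  refine ⟨hw, fun T hT => ?_⟩
  have h1 := hc.2 T hT
  simp only [intervalIntegral.integral_neg] at h1
  have h2 : ∀ t, stageCost Q R (fun t => C *ᵥ d t + E *ᵥ xbar t)
      (fun t => v t + Gam *ᵥ xbar t) t = _ := fun t => stageCost_eq_add_crossTerm hQ hR d v xbar t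
  rw [intervalIntegral.integral_congr fun t _ => h2 t, intervalIntegral.integral_add
    ((hbase T hT).add (hw T hT)) ((hcross T hT).const_mul 2),
    intervalIntegral.integral_add (hbase T hT) (hw T hT), intervalIntegral.integral_const_mul]
  linarith

/-- Relative to the stationary input, the tracking control is stabilizing feedback plus a term
driven by the synchronization error, so the deviation obeys the Hurwitz matrix A − BK with decaying
forcing. -/
theorem trackingControl_sub (K : Matrix (Fin m) (Fin n) ℝ) (x : ℝ → Fin n → ℝ)
    (xloc xbar : ℝ → ι → ℝ) (t : ℝ) :
    trackingControl K Pi Gam x xloc t - Gam *ᵥ xbar t =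
      -(K *ᵥ (x t - Pi *ᵥ xbar t)) + (K * Pi + Gam) *ᵥ (xloc t - xbar t) := by
  simp only [trackingControl, mulVec_sub, add_mulVec, ← mulVec_mulVec]
  abel

/-- The deviation under the tracking control and its input decay exponentially. -/
theorem exists_tracking_decay (hPi : Pi * Abar = A * Pi + B * Gam)
    {K : Matrix (Fin m) (Fin n) ℝ} (hK : IsHurwitz (A - B * K)) {xbar xloc : ℝ → ι → ℝ}
    (hxbar : IsPrimitive xbar (fun t => Abar *ᵥ xbar t)) (hloc : IsSynchronized xloc xbar)
    {x : ℝ → Fin n → ℝ}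
    (hx : IsPrimitive x (fun t => A *ᵥ x t + B *ᵥ trackingControl K Pi Gam x xloc t)) :
    ∃ c γ : ℝ, 0 < γ ∧ 0 ≤ c ∧ ∀ t, 0 ≤ t → ‖x t - Pi *ᵥ xbar t‖ ≤ c * Real.exp (-γ * t) ∧
      ‖trackingControl K Pi Gam x xloc t - Gam *ᵥ xbar t‖ ≤ c * Real.exp (-γ * t) := by
  obtain ⟨-, c, β, hβ, hcβ⟩ := hloc
  obtain ⟨b, hb, hbb⟩ := exists_norm_mulVec_le (B * (K * Pi + Gam))
  obtain ⟨k, hk, hkb⟩ := exists_norm_mulVec_le K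
  obtain ⟨k', hk', hkb'⟩ := exists_norm_mulVec_le (K * Pi + Gam)
  have hc0 : 0 ≤ c := by
    have := (norm_nonneg _).trans (hcβ 0 le_rfl)
    simpa using this
  have hd : IsPrimitive (fun t => x t - Pi *ᵥ xbar t)
      (fun t => (A - B * K) *ᵥ (x t - Pi *ᵥ xbar t) +
        (B * (K * Pi + Gam)) *ᵥ (xloc t - xbar t)) := by
    refine (isPrimitive_deviation hPi hxbar hx).congr (fun t _ => rfl) fun t _ => ?_
    rw [trackingControl_sub, sub_mulVec, mulVec_add, mulVec_neg, mulVec_mulVec, mulVec_mulVec]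
    abel
  obtain ⟨c', γ, hγ, hγβ, hc', hdb⟩ := hK.exists_exp_decay hd hβ (b := b * c) fun t ht => by
    rw [mul_assoc]
    exact (hbb _).trans (mul_le_mul_of_nonneg_left (hcβ t ht) hb)
  refine ⟨c' + (k * c' + k' * c), γ, hγ, by positivity, fun t ht => ⟨?_, ?_⟩⟩
  · refine (hdb t ht).trans (mul_le_mul_of_nonneg_right ?_ (Real.exp_pos _).le)
    have : 0 ≤ k * c' + k' * c := by positivity
    linarith
  · rw [trackingControl_sub]
    refine (norm_add_le _ _).trans ?_
    rw [norm_neg]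
    have h1 := (hkb (x t - Pi *ᵥ xbar t)).trans (mul_le_mul_of_nonneg_left (hdb t ht) hk)
    have h2 := (hkb' (xloc t - xbar t)).trans (mul_le_mul_of_nonneg_left (hcβ t ht) hk')
    have h3 : Real.exp (-β * t) ≤ Real.exp (-γ * t) := Real.exp_le_exp.2 (by nlinarith)
    have h4 := mul_le_mul_of_nonneg_left h3 (mul_nonneg hk' hc0)
    have h5 : 0 ≤ c' * Real.exp (-γ * t) := by positivity
    linarith

theorem integral_exp_neg_le {γ : ℝ} (hγ : 0 < γ) (T : ℝ) :
    ∫ t in (0 : ℝ)..T, Real.exp (-γ * t) ≤ 1 / γ := by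
  have h : ∀ s ∈ uIcc 0 T, HasDerivAt (fun s => -(Real.exp (-γ * s) / γ))
      (Real.exp (-γ * s)) s := by
    intro s _
    have h1 : HasDerivAt (fun s => -γ * s) (-γ) s := by
      simpa using (hasDerivAt_id s).const_mul (-γ)
    have := (h1.exp.div_const γ).neg
    convert! this using 1
    rw [mul_neg, neg_div, neg_neg, mul_div_assoc, div_self hγ.ne', mul_one]
  rw [intervalIntegral.integral_eq_sub_of_hasDerivAt h
    (Continuous.intervalIntegrable (by fun_prop) _ _)]
  have : 0 ≤ Real.exp (-γ * T) / γ := by positivity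
  simp only [mul_zero, Real.exp_zero]
  linarith

theorem exists_integral_stageCost_le {d : ℝ → Fin n → ℝ} {v : ℝ → Fin m → ℝ} {c γ : ℝ}
    (hγ : 0 < γ)
    (hint : ∀ T, 0 ≤ T → IntervalIntegrable (stageCost Q R (fun t => C *ᵥ d t) v) volume 0 T)
    (hd : ∀ t, 0 ≤ t → ‖d t‖ ≤ c * Real.exp (-γ * t))
    (hv : ∀ t, 0 ≤ t → ‖v t‖ ≤ c * Real.exp (-γ * t)) :
    ∃ W, ∀ T, 0 ≤ T → ∫ t in (0 : ℝ)..T, stageCost Q R (fun t => C *ᵥ d t) v t ≤ W := by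
  obtain ⟨q, hq, hqb⟩ := exists_dotProduct_mulVec_le Q
  obtain ⟨r, hr, hrb⟩ := exists_dotProduct_mulVec_le R
  obtain ⟨k, hk, hkb⟩ := exists_norm_mulVec_le C
  set b := q * (k * c) ^ 2 + r * c ^ 2 with hb
  have hb0 : 0 ≤ b := by positivity
  refine ⟨b * (1 / (2 * γ)), fun T hT => ?_⟩
  refine le_trans (intervalIntegral.integral_mono_on hT (hint T hT)
    (g := fun t => b * Real.exp (-(2 * γ) * t))
    (Continuous.intervalIntegrable (by fun_prop) _ _) fun t ht => ?_) ?_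
  · have h1 : ‖C *ᵥ d t‖ ≤ k * c * Real.exp (-γ * t) := by
      rw [mul_assoc]
      exact (hkb _).trans (mul_le_mul_of_nonneg_left (hd t ht.1) hk)
    have h2 := (hqb (C *ᵥ d t)).trans
      (mul_le_mul_of_nonneg_left (pow_le_pow_left₀ (norm_nonneg _) h1 2) hq)
    have h3 := (hrb (v t)).trans
      (mul_le_mul_of_nonneg_left (pow_le_pow_left₀ (norm_nonneg _) (hv t ht.1) 2) hr)
    have h4 : Real.exp (-(2 * γ) * t) = Real.exp (-γ * t) ^ 2 := by
      rw [← Real.exp_nat_mul]; congr 1; push_cast; ring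
    rw [h4, hb]
    refine (add_le_add h2 h3).trans (le_of_eq ?_)
    ring
  · rw [intervalIntegral.integral_const_mul]
    exact mul_le_mul_of_nonneg_left (integral_exp_neg_le (by positivity) T) hb0

/-- If the deviation of a detectable system does not vanish, then its energy diverges, and it
dominates the deviation. -/
theorem tendsto_energy_sub_norm (hAC : IsDetectable A C) (hQ : Q.PosDef) (hR : R.PosDef)
    {d : ℝ → Fin n → ℝ} {v : ℝ → Fin m → ℝ}
    (hd : IsPrimitive d (fun t => A *ᵥ d t + B *ᵥ v t))
    (hw : ∀ T, 0 ≤ T → IntervalIntegrable (stageCost Q R (fun t => C *ᵥ d t) v) volume 0 T)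
    (hnot : ¬ Tendsto d atTop (𝓝 0)) {b : ℝ} (hb : 0 ≤ b) :
    Tendsto (fun T => 2⁻¹ * (∫ t in (0 : ℝ)..T, stageCost Q R (fun t => C *ᵥ d t) v t) -
      b * ‖d T‖) atTop atTop := by
  obtain ⟨L, hL⟩ := hAC
  obtain ⟨κ, hκ, hκb⟩ := exists_injection_norm_sq_le B C L hQ hR
  have hd' : IsPrimitive d (fun t => (A - L * C) *ᵥ d t + (L *ᵥ (C *ᵥ d t) + B *ᵥ v t)) := by
    refine hd.congr (fun t _ => rfl) fun t _ => ?_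
    rw [sub_mulVec, mulVec_mulVec]
    abel
  have hw0 : ∀ t, 0 ≤ t → 0 ≤ stageCost Q R (fun t => C *ᵥ d t) v t := fun t _ =>
    stageCost_nonneg hQ hR t
  set W := fun T => ∫ t in (0 : ℝ)..T, stageCost Q R (fun t => C *ᵥ d t) v t with hW
  have hWt : Tendsto W atTop atTop := by
    -- Clamping at 0 makes the energy monotone on all of ℝ, so it diverges or converges; convergence
    -- would force d → 0.
    set W' := fun T => W (max T 0) with hW'
    have hmono : Monotone W' := fun s t hst =>
      integral_mono_right hw hw0 (le_max_right _ _) (max_le_max_right 0 hst)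
    have hev : W' =ᶠ[atTop] W :=
      (eventually_ge_atTop 0).mono fun t ht => by simp only [hW', max_eq_left ht]
    rcases tendsto_atTop_of_monotone hmono with h | ⟨l, h⟩
    · exact h.congr' hev
    · exact absurd (hL.tendsto_zero_of_energy hd' hw hw0 (fun t _ => hκb d v t)
        (h.congr' hev)) hnot
  obtain ⟨C₀, hC₀⟩ := hL.exists_norm_le_add_energy hκ hd' hw hw0 (fun t _ => hκb d v t)
    -- With this δ the term b‖d‖ consumes at most a quarter of W, which leaves a quarter out of the
    -- half.
    (δ := 1 / (4 * (b + 1))) (by positivity)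
  have h1 : Tendsto (fun T => 4⁻¹ * W T + -(b * C₀)) atTop atTop :=
    tendsto_atTop_add_const_right _ _ (hWt.const_mul_atTop (by norm_num))
  refine tendsto_atTop_mono' _ ((eventually_ge_atTop 0).mono fun T hT => ?_) h1
  have h2 := mul_le_mul_of_nonneg_left (hC₀ T hT) hb
  have hW0 : 0 ≤ W T := intervalIntegral.integral_nonneg hT fun t ht => hw0 t ht.1
  have h3 : b * (1 / (4 * (b + 1)) * W T) ≤ 4⁻¹ * W T := by
    have h4 : b * (1 / (4 * (b + 1))) ≤ 4⁻¹ := by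
      rw [mul_one_div, div_le_iff₀ (by positivity)]
      linarith
    rw [← mul_assoc]
    exact mul_le_mul_of_nonneg_right h4 hW0
  change 4⁻¹ * W T + -(b * C₀) ≤ 2⁻¹ * W T - b * ‖d T‖
  linarith

variable [DecidableEq ι]

/-- A solution of the Hamiltonian regulator equations with bounded exosystem trajectories gives
optimal stationary synchronization. -/
theorem isOSS_of_hamiltonian (hAC : IsDetectable A C) (hQ : Q.PosDef) (hR : R.PosDef)
    (hPi : Pi * Abar = A * Pi + B * Gam)
    (hL : PiLam * Abar = -(Aᵀ * PiLam) - Cᵀ * Q * (C * Pi - Cbar))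
    (hG : R * Gam = -(Bᵀ * PiLam))
    (hbdd : ∀ xbar0, ∃ b, ∀ t, 0 ≤ t → ‖exoTraj Abar xbar0 t‖ ≤ b) :
    IsOSS A B C Abar Cbar Q R Pi Gam := by
  refine ⟨hPi, fun K hK xbar0 x0 xloc hloc x hx u' x' hx' hnot => ?_⟩
  obtain ⟨b, hb⟩ := hbdd xbar0
  set xbar := exoTraj Abar xbar0 with hxbar_def
  have hxbar : IsPrimitive xbar (fun t => Abar *ᵥ xbar t) := isPrimitive_exoTraj Abar xbar0
  set u := trackingControl K Pi Gam x xloc with hu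
  have he : ∀ y : ℝ → Fin n → ℝ, (fun t => C *ᵥ y t - Cbar *ᵥ xbar t) =
      fun t => C *ᵥ (y t - Pi *ᵥ xbar t) + (C * Pi - Cbar) *ᵥ xbar t := by
    intro y; funext t
    rw [mulVec_sub, sub_mulVec, mulVec_mulVec]; abel
  have hv : ∀ y : ℝ → Fin m → ℝ, y = fun t => (y t - Gam *ᵥ xbar t) + Gam *ᵥ xbar t := by
    intro y; funext t; simp
  have hd := isPrimitive_deviation hPi hxbar hx.isPrimitive
  have hd' := isPrimitive_deviation hPi hxbar hx'.isPrimitive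
  have hxc := hx.2.1
  have hxbc := hxbar.continuousOn
  have hlc := hloc.1
  have huc : ContinuousOn u (Ici 0) :=
    ((continuousOn_mulVec K (hxc.sub (continuousOn_mulVec Pi hlc))).neg).add
      (continuousOn_mulVec Gam hlc)
  have hec : ∀ {y : ℝ → Fin n → ℝ}, ContinuousOn y (Ici 0) →
      ContinuousOn (fun t => C *ᵥ y t - Cbar *ᵥ xbar t) (Ici 0) := fun hy =>
    (continuousOn_mulVec C hy).sub (continuousOn_mulVec Cbar hxbc)
  have hint : ∀ T, 0 ≤ T → IntervalIntegrable
      (stageCost Q R (fun t => C *ᵥ x t - Cbar *ᵥ xbar t) u) volume 0 T := fun T hT =>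
    ((continuousOn_stageCost (hec hxc) huc).mono (uIcc_zero_subset hT)).intervalIntegrable
  -- If the competitor's stage cost is not locally integrable, its cost is eventually infinite while
  -- the tracking cost is finite.
  by_cases hint' : ∀ T, 0 ≤ T → IntervalIntegrable
      (stageCost Q R (fun t => C *ᵥ x' t - Cbar *ᵥ xbar t) u') volume 0 T
  swap
  · push Not at hint'
    obtain ⟨S, hS, hSn⟩ := hint'
    refine tendsto_nhds_of_eventually_eq ((eventually_ge_atTop S).mono fun T hT => ?_)
    rw [cost_eq_coe hQ hR (hS.trans hT) (hint T (hS.trans hT)),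
      cost_eq_top hQ hR hS hT (hec hx'.2.1) (hx'.1 S hS) hSn]
    rfl
  obtain ⟨c, γ, hγ, hc, hcb⟩ := exists_tracking_decay hPi hK hxbar hloc hx.isPrimitive
  have hint1 := hint
  have hint1' := hint'
  rw [he x, hv u] at hint1
  rw [he x', hv u'] at hint1'
  obtain ⟨hw, hJ⟩ := integral_stageCost_eq hQ.transpose_eq hR.transpose_eq hL hG hxbar hd hint1
  obtain ⟨hw', hJ'⟩ := integral_stageCost_eq hQ.transpose_eq hR.transpose_eq hL hG hxbar hd' hint1'
  rw [← he x, ← hv u] at hJ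
  rw [← he x', ← hv u'] at hJ'
  obtain ⟨W, hW⟩ := exists_integral_stageCost_le hγ hw (fun t ht => (hcb t ht).1)
    fun t ht => (hcb t ht).2
  obtain ⟨l, hl, hlb⟩ := exists_norm_mulVec_le PiLam
  have hb0 : 0 ≤ b := (norm_nonneg _).trans (hb 0 le_rfl)
  have hbl : ∀ t, 0 ≤ t → ∀ d : Fin n → ℝ, |(PiLam *ᵥ xbar t) ⬝ᵥ d| ≤ n * (l * b) * ‖d‖ := by
    intro t ht d
    refine (abs_dotProduct_le _ _).trans ?_
    rw [Fintype.card_fin]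
    have := (hlb (xbar t)).trans (mul_le_mul_of_nonneg_left (hb t ht) hl)
    gcongr
  have h00 : x' 0 - Pi *ᵥ xbar 0 = x 0 - Pi *ᵥ xbar 0 := by
    have h1 : x 0 = x0 := by simpa using hx.2.2 0 le_rfl
    have h2 : x' 0 = x0 := by simpa using hx'.2.2 0 le_rfl
    rw [h1, h2]
  have hmain := tendsto_energy_sub_norm hAC hQ hR hd' hw' hnot (b := n * (l * b)) (by positivity)
  -- The subtracted constant bounds the energy and the final boundary term of the tracking control.
  have hmain' := tendsto_atTop_add_const_right atTop (-(2⁻¹ * W + n * (l * b) * c)) hmain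
  have hreal : Tendsto (fun T : ℝ =>
      2⁻¹ * (∫ t in (0 : ℝ)..T, stageCost Q R (fun t => C *ᵥ x' t - Cbar *ᵥ xbar t) u' t) -
      2⁻¹ * (∫ t in (0 : ℝ)..T, stageCost Q R (fun t => C *ᵥ x t - Cbar *ᵥ xbar t) u t))
      atTop atTop := by
    refine tendsto_atTop_mono' _ ((eventually_ge_atTop 0).mono fun T hT => ?_) hmain'
    simp only
    rw [hJ T hT, hJ' T hT, h00]
    have h1 := (abs_le.1 (hbl T hT (x T - Pi *ᵥ xbar T))).1
    have h2 := (abs_le.1 (hbl T hT (x' T - Pi *ᵥ xbar T))).2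
    have h3 : ‖x T - Pi *ᵥ xbar T‖ ≤ c := (hcb T hT).1.trans
      (mul_le_of_le_one_right hc (Real.exp_le_one_iff.2 (by nlinarith)))
    have h4 := mul_le_mul_of_nonneg_left h3 (by positivity : 0 ≤ n * (l * b))
    have h5 := hW T hT
    linarith
  refine (EReal.tendsto_coe_nhds_top_iff.2 hreal).congr'
    ((eventually_ge_atTop 0).mono fun T hT => ?_)
  simp only
  rw [cost_eq_coe hQ hR hT (hint T hT), cost_eq_coe hQ hR hT (hint' T hT), EReal.coe_sub]

end OptimalSynchronization

/-! ### Solving the Hamiltonian equations through a constrained quadratic program. -/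

section KarushKuhnTucker

open Matrix

/-- Stationary points of a symmetric quadratic functional on the kernel of `L` exist, with a
Lagrange multiplier, if the linear part vanishes on the isotropic vectors. -/
theorem exists_stationary_point {V U : Type*} [AddCommGroup V] [Module ℝ V] [FiniteDimensional ℝ V]
    [AddCommGroup U] [Module ℝ U] (L : V →ₗ[ℝ] U) (β : V →ₗ[ℝ] V →ₗ[ℝ] ℝ)
    (hβ : ∀ v w, β v w = β w v) (f : V →ₗ[ℝ] ℝ) (hf : ∀ v, L v = 0 → β v v = 0 → f v = 0) :
    ∃ (v : V) (φ : U →ₗ[ℝ] ℝ), L v = 0 ∧ ∀ w, β v w - f w = φ (L w) := by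
  let K := LinearMap.ker L
  let βK : K →ₗ[ℝ] K →ₗ[ℝ] ℝ := β.domRestrict₁₂ K K
  -- The form may be degenerate on the kernel of L. In finite dimension it still represents f there,
  -- because f vanishes on the radical, whose vectors are isotropic.
  have h1 : f.domRestrict K ∈ (LinearMap.ker βK).dualAnnihilator := by
    refine (Submodule.mem_dualAnnihilator _).2 fun k hk => hf k (LinearMap.mem_ker.1 k.2) ?_
    exact LinearMap.congr_fun (LinearMap.mem_ker.1 hk) k
  rw [LinearMap.dualAnnihilator_ker_eq_range_flip] at h1
  obtain ⟨v, hv⟩ := h1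
  have h2 : β v - f ∈ (LinearMap.ker L).dualAnnihilator := by
    refine (Submodule.mem_dualAnnihilator _).2 fun w hw => ?_
    have h3 : β w v = f w := LinearMap.congr_fun hv ⟨w, hw⟩
    rw [LinearMap.sub_apply, hβ, h3, sub_self]
  rw [← LinearMap.range_dualMap_eq_dualAnnihilator_ker] at h2
  obtain ⟨φ, hφ⟩ := h2
  exact ⟨v, φ, LinearMap.mem_ker.1 v.2, fun w => (LinearMap.congr_fun hφ w).symm⟩

variable {ι : Type*} [Fintype ι] {n m p : ℕ}

/-- Riesz representation for the trace pairing; it turns the abstract Lagrange multiplier into a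
matrix. -/
theorem exists_trace_transpose_mul_eq {κ : Type*} [Fintype κ] [DecidableEq κ]
    [DecidableEq ι]
    (φ : Matrix κ ι ℝ →ₗ[ℝ] ℝ) : ∃ M : Matrix κ ι ℝ, ∀ U, φ U = (Mᵀ * U).trace := by
  refine ⟨Matrix.of fun i j => φ (Matrix.single i j 1), fun U => ?_⟩
  have h1 : φ U = ∑ i, ∑ j, U i j * φ (Matrix.single i j 1) := by
    conv_lhs => rw [Matrix.matrix_eq_sum_single U]
    simp only [map_sum]
    refine Finset.sum_congr rfl fun i _ => Finset.sum_congr rfl fun j _ => ?_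
    rw [← smul_eq_mul, ← map_smul, Matrix.smul_single, smul_eq_mul, mul_one]
  rw [h1, Finset.sum_comm]
  simp [Matrix.trace, Matrix.mul_apply, mul_comm]

theorem trace_transpose_mul_self_eq {κ : Type*} [Fintype κ] (M : Matrix κ ι ℝ) :
    (Mᵀ * M).trace = ∑ j, ∑ i, M i j ^ 2 := by
  simp [Matrix.trace, Matrix.mul_apply, sq]

theorem trace_transpose_mul_self_nonneg {κ : Type*} [Fintype κ] (M : Matrix κ ι ℝ) :
    0 ≤ (Mᵀ * M).trace := by
  rw [trace_transpose_mul_self_eq]; positivity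

theorem sq_entry_le_trace {κ : Type*} [Fintype κ] (M : Matrix κ ι ℝ) (i : κ) (j : ι) :
    M i j ^ 2 ≤ (Mᵀ * M).trace := by
  rw [trace_transpose_mul_self_eq]
  exact (Finset.single_le_sum (f := fun i => M i j ^ 2) (fun _ _ => sq_nonneg _)
    (Finset.mem_univ i)).trans (Finset.single_le_sum (f := fun j => ∑ i, M i j ^ 2)
      (fun _ _ => by positivity) (Finset.mem_univ j))

theorem trace_weighted_nonneg {R : Matrix (Fin m) (Fin m) ℝ} (hR : R.PosDef)
    (G : Matrix (Fin m) ι ℝ) : 0 ≤ (Gᵀ * R * G).trace := by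
  have := (hR.posSemidef.conjTranspose_mul_mul_same G).trace_nonneg
  rwa [conjTranspose_eq_transpose_of_trivial] at this

theorem trace_weighted_comm {R : Matrix (Fin m) (Fin m) ℝ} (hR : Rᵀ = R)
    (G H : Matrix (Fin m) ι ℝ) : (Gᵀ * R * H).trace = (Hᵀ * R * G).trace := by
  rw [← Matrix.trace_transpose]
  simp [Matrix.transpose_mul, hR, Matrix.mul_assoc]

theorem two_mul_trace_weighted_le {R : Matrix (Fin m) (Fin m) ℝ} (hR : R.PosDef)
    (G H : Matrix (Fin m) ι ℝ) :
    2 * (Gᵀ * R * H).trace ≤ (Gᵀ * R * G).trace + (Hᵀ * R * H).trace := by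
  have h := trace_weighted_nonneg hR (G - H)
  have h2 := trace_weighted_comm hR.transpose_eq G H
  simp only [transpose_sub, Matrix.sub_mul, Matrix.mul_sub, Matrix.trace_sub] at h
  linarith

/-- A block matrix with positive definite diagonal blocks is positive definite if the off-diagonal
block is small. -/
theorem exists_posDef_fromBlocks {P : Matrix ι ι ℝ} {X : Matrix (Fin p) (Fin p) ℝ}
    (hP : P.PosDef) (hX : X.PosDef) : ∃ δ : ℝ, 0 < δ ∧ ∀ E : Matrix (Fin p) ι ℝ,
      (∀ i j, |E i j| ≤ δ) → (Matrix.fromBlocks P Eᵀ E X).PosDef := by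
  obtain ⟨a, ha, hPa⟩ := hP.exists_mul_norm_sq_le
  obtain ⟨b, hb, hXb⟩ := hX.exists_mul_norm_sq_le
  set μ := min a b with hμ
  have hμ0 : 0 < μ := lt_min ha hb
  set k : ℝ := p * Fintype.card ι with hk
  have hk0 : 0 ≤ k := by positivity
  -- The factor k counts the entries of E. The cross term is then at least −μ‖x‖‖y‖ and costs at
  -- most half of μ(‖x‖² + ‖y‖²).
  refine ⟨μ / (2 * (k + 1)), by positivity, fun E hE => ?_⟩
  refine .of_dotProduct_mulVec_pos ?_ fun z hz => ?_
  · rw [IsHermitian, conjTranspose_eq_transpose_of_trivial, fromBlocks_transpose,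
      hP.transpose_eq, hX.transpose_eq, transpose_transpose]
  set x := z ∘ Sum.inl with hx
  set y := z ∘ Sum.inr with hy
  have hEx : ‖E *ᵥ x‖ ≤ Fintype.card ι * (μ / (2 * (k + 1))) * ‖x‖ := by
    refine (pi_norm_le_iff_of_nonneg (by positivity)).2 fun i => ?_
    calc ‖(E *ᵥ x) i‖ ≤ ∑ j, ‖E i j * x j‖ := norm_sum_le _ _
      _ ≤ ∑ _j : ι, μ / (2 * (k + 1)) * ‖x‖ := by
          refine Finset.sum_le_sum fun j _ => ?_
          rw [norm_mul]
          exact mul_le_mul (hE i j) (norm_le_pi_norm x j) (norm_nonneg _) (by positivity)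
      _ = _ := by simp; ring
  have hcross : -(μ / 2 * (‖y‖ * ‖x‖)) ≤ y ⬝ᵥ (E *ᵥ x) := by
    refine le_trans (neg_le_neg ?_) (abs_le.1 (abs_dotProduct_le y (E *ᵥ x))).1
    rw [Fintype.card_fin]
    calc (p : ℝ) * ‖y‖ * ‖E *ᵥ x‖ ≤ p * ‖y‖ * (Fintype.card ι * (μ / (2 * (k + 1))) * ‖x‖) :=
          mul_le_mul_of_nonneg_left hEx (by positivity)
      _ = μ / 2 * (k / (k + 1)) * (‖y‖ * ‖x‖) := by rw [hk]; field_simp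
      _ ≤ μ / 2 * (‖y‖ * ‖x‖) := by
          refine mul_le_mul_of_nonneg_right ?_ (by positivity)
          exact mul_le_of_le_one_right (by positivity) ((div_le_one (by positivity)).2 (by linarith))
  have hform : star z ⬝ᵥ (fromBlocks P Eᵀ E X *ᵥ z) =
      x ⬝ᵥ (P *ᵥ x) + 2 * (y ⬝ᵥ (E *ᵥ x)) + y ⬝ᵥ (X *ᵥ y) := by
    rw [fromBlocks_mulVec, dotProduct_block]
    simp only [Sum.elim_comp_inl, Sum.elim_comp_inr, star_trivial, dotProduct_add]
    rw [← hx, ← hy, dotProduct_transpose_mulVec]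
    ring
  rw [hform]
  have hne : 0 < ‖x‖ ^ 2 + ‖y‖ ^ 2 := by
    by_contra hcon
    have h1 : ‖x‖ = 0 := by nlinarith [sq_nonneg ‖x‖, sq_nonneg ‖y‖]
    have h2 : ‖y‖ = 0 := by nlinarith [sq_nonneg ‖x‖, sq_nonneg ‖y‖]
    refine hz (funext fun i => ?_)
    rcases i with i | i
    · exact congrFun (norm_eq_zero.1 h1) i
    · exact congrFun (norm_eq_zero.1 h2) i
  have h1 := (mul_le_mul_of_nonneg_right (min_le_left a b) (sq_nonneg ‖x‖)).trans (hPa x)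
  have h2 := (mul_le_mul_of_nonneg_right (min_le_right a b) (sq_nonneg ‖y‖)).trans (hXb y)
  have h3 : 2 * (‖y‖ * ‖x‖) ≤ ‖x‖ ^ 2 + ‖y‖ ^ 2 := by nlinarith [sq_nonneg (‖x‖ - ‖y‖)]
  have h4 := mul_le_mul_of_nonneg_left h3 hμ0.le
  have h5 := mul_pos hμ0 hne
  linarith

variable [DecidableEq ι]

/-- For a skew-symmetric exosystem and the output weight `q I`, the Hamiltonian regulator
equations have a solution whose output error is small for large `q`. -/
theorem exists_hamiltonian_solution {A : Matrix (Fin n) (Fin n) ℝ} {B : Matrix (Fin n) (Fin m) ℝ}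
    {C : Matrix (Fin p) (Fin n) ℝ} {Abar : Matrix ι ι ℝ} {Cbar : Matrix (Fin p) ι ℝ}
    {R : Matrix (Fin m) (Fin m) ℝ} (hR : R.PosDef) (hskew : Abarᵀ = -Abar)
    {Pi₀ : Matrix (Fin n) ι ℝ} {Gam₀ : Matrix (Fin m) ι ℝ}
    (h₀ : Pi₀ * Abar = A * Pi₀ + B * Gam₀) (hC₀ : C * Pi₀ = Cbar) {q : ℝ} (hq : 0 < q) :
    ∃ (Pi : Matrix (Fin n) ι ℝ) (Gam : Matrix (Fin m) ι ℝ) (PiLam : Matrix (Fin n) ι ℝ),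
      Pi * Abar = A * Pi + B * Gam ∧
      PiLam * Abar = -(Aᵀ * PiLam) - Cᵀ * (q • (1 : Matrix (Fin p) (Fin p) ℝ)) * (C * Pi - Cbar) ∧
      R * Gam = -(Bᵀ * PiLam) ∧
      q * ((C * Pi - Cbar)ᵀ * (C * Pi - Cbar)).trace ≤ (Gam₀ᵀ * R * Gam₀).trace := by
  let L : (Matrix (Fin n) ι ℝ × Matrix (Fin m) ι ℝ) →ₗ[ℝ] Matrix (Fin n) ι ℝ :=
    { toFun := fun z => A * z.1 + B * z.2 - z.1 * Abar
      map_add' := fun z w => by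
        simp only [Prod.fst_add, Prod.snd_add, Matrix.mul_add, Matrix.add_mul]; abel
      map_smul' := fun c z => by
        simp only [Prod.smul_fst, Prod.smul_snd, Matrix.mul_smul, Matrix.smul_mul, smul_add,
          smul_sub, RingHom.id_apply] }
  let β := LinearMap.mk₂ ℝ
    (fun z w : Matrix (Fin n) ι ℝ × Matrix (Fin m) ι ℝ => q * ((C * z.1)ᵀ * (C * w.1)).trace +
      (z.2ᵀ * R * w.2).trace)
    (fun z z' w => by
      simp only [Prod.fst_add, Prod.snd_add, Matrix.mul_add, Matrix.add_mul, transpose_add,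
        Matrix.trace_add]; ring)
    (fun c z w => by
      simp only [Prod.smul_fst, Prod.smul_snd, Matrix.mul_smul, Matrix.smul_mul, transpose_smul,
        Matrix.trace_smul, smul_eq_mul]; ring)
    (fun z w w' => by
      simp only [Prod.fst_add, Prod.snd_add, Matrix.mul_add, Matrix.trace_add]; ring)
    (fun c z w => by
      simp only [Prod.smul_fst, Prod.smul_snd, Matrix.mul_smul, Matrix.trace_smul, smul_eq_mul]
      ring)
  let f : (Matrix (Fin n) ι ℝ × Matrix (Fin m) ι ℝ) →ₗ[ℝ] ℝ :=
    { toFun := fun w => q * (Cbarᵀ * (C * w.1)).trace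
      map_add' := fun z w => by
        simp only [Prod.fst_add, Matrix.mul_add, Matrix.trace_add]; ring
      map_smul' := fun c z => by
        simp only [Prod.smul_fst, Matrix.mul_smul, Matrix.trace_smul, smul_eq_mul,
          RingHom.id_apply]; ring }
  have hβs : ∀ v w, β v w = β w v := by
    intro v w
    change q * ((C * v.1)ᵀ * (C * w.1)).trace + (v.2ᵀ * R * w.2).trace =
      q * ((C * w.1)ᵀ * (C * v.1)).trace + (w.2ᵀ * R * v.2).trace
    rw [trace_weighted_comm hR.transpose_eq v.2 w.2, ← Matrix.trace_transpose,
      Matrix.transpose_mul, Matrix.transpose_transpose]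
  have hf : ∀ v, L v = 0 → β v v = 0 → f v = 0 := by
    intro v _ hv
    change q * ((C * v.1)ᵀ * (C * v.1)).trace + (v.2ᵀ * R * v.2).trace = 0 at hv
    have h1 := trace_weighted_nonneg hR v.2
    have h2 := trace_transpose_mul_self_nonneg (C * v.1)
    have h3 : ((C * v.1)ᵀ * (C * v.1)).trace = 0 := by nlinarith
    have h4 : C * v.1 = 0 := by
      ext i j
      have := sq_entry_le_trace (C * v.1) i j
      rw [h3] at this
      exact pow_eq_zero_iff (two_ne_zero) |>.1 (le_antisymm this (sq_nonneg _))
    change q * (Cbarᵀ * (C * v.1)).trace = 0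
    rw [h4]; simp
  obtain ⟨⟨Pi, Gam⟩, φ, hL, hφ⟩ := exists_stationary_point L β hβs f hf
  obtain ⟨Lam, hLam⟩ := exists_trace_transpose_mul_eq φ
  have hkkt : ∀ (X : Matrix (Fin n) ι ℝ) (Y : Matrix (Fin m) ι ℝ),
      q * ((C * Pi - Cbar)ᵀ * (C * X)).trace + (Gamᵀ * R * Y).trace =
        (Lamᵀ * (A * X + B * Y - X * Abar)).trace := by
    intro X Y
    have h := hφ (X, Y)
    rw [hLam] at h
    change q * ((C * Pi)ᵀ * (C * X)).trace + (Gamᵀ * R * Y).trace - q * (Cbarᵀ * (C * X)).trace =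
      (Lamᵀ * (A * X + B * Y - X * Abar)).trace at h
    rw [← h, transpose_sub, Matrix.sub_mul, Matrix.trace_sub]
    ring
  have hPi : Pi * Abar = A * Pi + B * Gam := (sub_eq_zero.1 hL).symm
  refine ⟨Pi, Gam, -Lam, hPi, ?_, ?_, ?_⟩
  -- Variation of Π alone. After transposition, skewness of the exosystem matrix gives the sign that
  -- the costate equation requires.
  · have h1 : q • ((C * Pi - Cbar)ᵀ * C) = Lamᵀ * A - Abar * Lamᵀ := by
      refine Matrix.ext_iff_trace_mul_right.2 fun X => ?_
      have h := hkkt X 0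
      simp only [Matrix.mul_zero, Matrix.trace_zero, add_zero, Matrix.mul_sub,
        Matrix.trace_sub] at h
      rw [Matrix.smul_mul, Matrix.trace_smul, Matrix.sub_mul, Matrix.trace_sub, smul_eq_mul,
        Matrix.mul_assoc, h, Matrix.mul_assoc, Matrix.mul_assoc Abar, Matrix.trace_mul_comm Abar,
        Matrix.mul_assoc]
    have h2 := congrArg Matrix.transpose h1
    simp only [transpose_smul, transpose_mul, transpose_sub (Lamᵀ * A), transpose_transpose,
      hskew] at h2
    rw [Matrix.mul_smul, Matrix.mul_one, Matrix.smul_mul, h2]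
    simp
  · have h1 : Gamᵀ * R = Lamᵀ * B := by
      refine Matrix.ext_iff_trace_mul_right.2 fun Y => ?_
      have h := hkkt 0 Y
      simpa [Matrix.mul_assoc] using h
    have h2 := congrArg Matrix.transpose h1
    simp only [transpose_mul, transpose_transpose, hR.transpose_eq] at h2
    rw [h2]; simp
  -- Testing stationarity in the direction of the exact regulator solution removes the multiplier,
  -- because both pairs satisfy the linear constraint.
  · have h := hkkt (Pi₀ - Pi) (Gam₀ - Gam)
    have h1 : A * (Pi₀ - Pi) + B * (Gam₀ - Gam) - (Pi₀ - Pi) * Abar = 0 := by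
      rw [Matrix.sub_mul, h₀, hPi, Matrix.mul_sub, Matrix.mul_sub]; abel
    have h2 : C * (Pi₀ - Pi) = -(C * Pi - Cbar) := by
      rw [Matrix.mul_sub, hC₀]; abel
    rw [h1, h2, Matrix.mul_zero, Matrix.trace_zero, Matrix.mul_neg, Matrix.trace_neg,
      Matrix.mul_sub (Gamᵀ * R), Matrix.trace_sub (Gamᵀ * R * Gam₀)] at h
    have h3 := two_mul_trace_weighted_le hR Gam Gam₀
    have h4 := trace_weighted_nonneg hR Gam
    have h5 := trace_weighted_nonneg hR Gam₀
    linarith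

end KarushKuhnTucker

/-! ### Invariant ellipsoids and output bounds. -/

section Lyapunov

open Matrix

variable {ι : Type*} [Fintype ι] [DecidableEq ι]

theorem exoTraj_zero (M : Matrix ι ι ℝ) (v : ι → ℝ) : exoTraj M v 0 = v := by
  simp [exoTraj]

/-- A quadratic form solving the Lyapunov equation is constant along trajectories. -/
theorem dotProduct_mulVec_exoTraj {M P : Matrix ι ι ℝ} (h : P * M + Mᵀ * P = 0) (v : ι → ℝ)
    {t : ℝ} (ht : 0 ≤ t) : exoTraj M v t ⬝ᵥ (P *ᵥ exoTraj M v t) = v ⬝ᵥ (P *ᵥ v) := by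
  have hx := isPrimitive_exoTraj M v
  have h1 := (hx.dotProduct (hx.mulVec P)).2 t ht
  have h2 : ∀ x : ι → ℝ, (M *ᵥ x) ⬝ᵥ (P *ᵥ x) + x ⬝ᵥ (P *ᵥ (M *ᵥ x)) = 0 := by
    intro x
    have h3 : (M *ᵥ x) ⬝ᵥ (P *ᵥ x) = x ⬝ᵥ ((Mᵀ * P) *ᵥ x) := by
      rw [← mulVec_mulVec, dotProduct_transpose_mulVec, dotProduct_comm]
    rw [h3, mulVec_mulVec, ← dotProduct_add, ← add_mulVec, add_comm, h, zero_mulVec,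
      dotProduct_zero]
  simp only [h2, intervalIntegral.integral_zero, add_zero, exoTraj_zero] at h1
  exact h1

theorem exists_norm_exoTraj_le {M P : Matrix ι ι ℝ} (hP : P.PosDef) (h : P * M + Mᵀ * P = 0)
    (v : ι → ℝ) : ∃ b, ∀ t, 0 ≤ t → ‖exoTraj M v t‖ ≤ b := by
  obtain ⟨a, ha, hb⟩ := hP.exists_mul_norm_sq_le
  refine ⟨Real.sqrt (v ⬝ᵥ (P *ᵥ v) / a), fun t ht => Real.le_sqrt_of_sq_le ?_⟩
  rw [le_div_iff₀ ha, mul_comm, ← dotProduct_mulVec_exoTraj h v ht]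
  exact hb _

omit [DecidableEq ι] in
/-- The Schur complement condition bounds the components of `E x` on the ellipsoid of `P`. -/
theorem abs_mulVec_le_of_fromBlocks_posDef {p : ℕ} {P : Matrix ι ι ℝ}
    {X : Matrix (Fin p) (Fin p) ℝ} {E : Matrix (Fin p) ι ℝ}
    (h : (Matrix.fromBlocks P Eᵀ E X).PosDef) {x : ι → ℝ} (hx : x ⬝ᵥ (P *ᵥ x) ≤ 1) {j : Fin p}
    {e : ℝ} (he : 0 ≤ e) (hj : X j j ≤ e ^ 2) : |(E *ᵥ x) j| ≤ e := by
  -- Test the block form on (x, s eⱼ). The discriminant of this quadratic in s yields (Ex)ⱼ² ≤ Xⱼⱼ ·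
  -- xᵀPx without inverting P or X.
  have h1 : ∀ s : ℝ, 0 ≤ X j j * (s * s) + 2 * (E *ᵥ x) j * s + x ⬝ᵥ (P *ᵥ x) := by
    intro s
    have h2 := h.dotProduct_nonneg (Sum.elim x (Pi.single j s))
    rw [fromBlocks_mulVec, dotProduct_block] at h2
    simp only [Sum.elim_comp_inl, Sum.elim_comp_inr, dotProduct_add] at h2
    rw [dotProduct_transpose_mulVec] at h2
    simp only [single_dotProduct, mulVec_single] at h2
    simp at h2
    linarith
  have h2 := discrim_le_zero h1
  have h3 : (E *ᵥ x) j ^ 2 ≤ X j j * (x ⬝ᵥ (P *ᵥ x)) := by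
    rw [discrim] at h2; linarith
  have h0 : 0 ≤ X j j := by
    by_contra hneg
    have h4 := h.diag_pos (i := Sum.inr j)
    simp at h4
    linarith
  refine abs_le_of_sq_le_sq ?_ he
  calc _ ≤ _ := h3
    _ ≤ X j j * 1 := mul_le_mul_of_nonneg_left hx h0
    _ ≤ e ^ 2 := by linarith

end Lyapunov

/-! ### Block-diagonal Lyapunov solutions of the harmonic exosystem. -/

section Exosystem

open Matrix

variable {m₀ N : ℕ} {mult : Fin N → ℕ} {ω : Fin N → ℝ}

theorem exoMatrix_transpose (ω : Fin N → ℝ) :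
    (exoMatrix m₀ mult ω)ᵀ = -exoMatrix m₀ mult ω := by
  ext a b
  rcases a with a | ⟨h, k⟩ <;> rcases b with b | ⟨h', k'⟩
  · simp [exoMatrix]
  · simp [exoMatrix]
  · simp [exoMatrix]
  by_cases hh : h = h'
  · subst hh
    fin_cases k <;> fin_cases k' <;> simp [exoMatrix]
  · simp [exoMatrix, diagonal_apply_ne _ hh, diagonal_apply_ne _ (Ne.symm hh)]

theorem mul_exoMatrix_apply (P : Matrix (ExoIdx m₀ mult) (ExoIdx m₀ mult) ℝ)
    (a : ExoIdx m₀ mult) (h : Σ j : Fin N, Fin (mult j)) :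
    (P * exoMatrix m₀ mult ω) a (Sum.inr (h, 0)) = -(ω h.1 * P a (Sum.inr (h, 1))) ∧
    (P * exoMatrix m₀ mult ω) a (Sum.inr (h, 1)) = ω h.1 * P a (Sum.inr (h, 0)) := by
  constructor <;>
  · simp only [Matrix.mul_apply, Fintype.sum_sum_type, Fintype.sum_prod_type, Fin.sum_univ_two,
      exoMatrix, fromBlocks_apply₁₂, fromBlocks_apply₂₂, kroneckerMap_apply, Matrix.zero_apply, mul_zero,
      Finset.sum_const_zero, zero_add, diagonal_apply]
    rw [Finset.sum_eq_single h]
    · simp [mul_comm]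
    · intro b _ hb; simp [hb]
    · simp

/-- A block-diagonal symmetric solution of the Lyapunov equation of the exosystem is diagonal, and
scalar on every harmonic subsystem. -/
theorem eq_diagonal_of_lyapunov (hω : ∀ j, 0 < ω j)
    {P : Matrix (ExoIdx m₀ mult) (ExoIdx m₀ mult) ℝ} (hsymm : Pᵀ = P)
    (hblock : ∀ a b, subsystem a ≠ subsystem b → P a b = 0)
    (hlyap : P * exoMatrix m₀ mult ω + (exoMatrix m₀ mult ω)ᵀ * P = 0) :
    P = diagonal (fun a => P a a) ∧
      ∀ h, P (Sum.inr (h, 0)) (Sum.inr (h, 0)) = P (Sum.inr (h, 1)) (Sum.inr (h, 1)) := by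
  have hs : ∀ a b, P a b = P b a := fun a b => congrFun (congrFun hsymm b) a
  have hT : (exoMatrix m₀ mult ω)ᵀ * P = (P * exoMatrix m₀ mult ω)ᵀ := by
    rw [transpose_mul, hsymm]
  rw [hT] at hlyap
  have hL : ∀ a b, (P * exoMatrix m₀ mult ω) a b + (P * exoMatrix m₀ mult ω) b a = 0 :=
    fun a b => congrFun (congrFun hlyap a) b
  -- On a harmonic block the (0, 0) entry of the Lyapunov equation reads −2ωP₀₁ = 0; below, the (0,
  -- 1) entry reads ω(P₀₀ − P₁₁) = 0.
  have h01 : ∀ h, P (Sum.inr (h, 0)) (Sum.inr (h, 1)) = 0 := by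
    intro h
    have h1 := hL (Sum.inr (h, 0)) (Sum.inr (h, 0))
    rw [(mul_exoMatrix_apply P _ h).1] at h1
    have h2 : ω h.1 * P (Sum.inr (h, 0)) (Sum.inr (h, 1)) = 0 := by linarith
    exact (mul_eq_zero.1 h2).resolve_left (hω _).ne'
  refine ⟨?_, fun h => ?_⟩
  · ext a b
    by_cases hab : a = b
    · subst hab; simp
    rw [diagonal_apply_ne _ hab]
    by_cases hsub : subsystem a = subsystem b
    swap
    · exact hblock a b hsub
    rcases a with a | ⟨h, k⟩ <;> rcases b with b | ⟨h', k'⟩ <;> simp [subsystem] at hsub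
    · exact absurd (by rw [hsub]) hab
    · subst hsub
      fin_cases k <;> fin_cases k'
      · exact absurd rfl hab
      · exact h01 h
      · rw [hs]; exact h01 h
      · exact absurd rfl hab
  · have h1 := hL (Sum.inr (h, 0)) (Sum.inr (h, 1))
    rw [(mul_exoMatrix_apply P _ h).1, (mul_exoMatrix_apply P _ h).2] at h1
    have h2 : ω h.1 * (P (Sum.inr (h, 0)) (Sum.inr (h, 0)) -
        P (Sum.inr (h, 1)) (Sum.inr (h, 1))) = 0 := by linarith
    exact sub_eq_zero.1 ((mul_eq_zero.1 h2).resolve_left (hω _).ne')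

/-- Since P is scalar on each harmonic block, only amplitudes matter and (0, 1) represents every
phase. The form is a positive combination of squared heights and amplitudes, each at most its value
1 at `boundaryVec`. -/
theorem normalizedSet_subset_ellipsoid (hω : ∀ j, 0 < ω j)
    {P : Matrix (ExoIdx m₀ mult) (ExoIdx m₀ mult) ℝ} (hP : P.PosDef)
    (hblock : ∀ a b, subsystem a ≠ subsystem b → P a b = 0)
    (hlyap : P * exoMatrix m₀ mult ω + (exoMatrix m₀ mult ω)ᵀ * P = 0)
    (hbdry : boundaryVec ⬝ᵥ (P *ᵥ boundaryVec) ≤ 1) : normalizedSet m₀ mult ⊆ ellipsoid P := by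
  obtain ⟨hdiag, heq⟩ := eq_diagonal_of_lyapunov hω hP.transpose_eq hblock hlyap
  have hpos : ∀ a, 0 < P a a := fun a => hP.diag_pos
  have hform : ∀ x : ExoIdx m₀ mult → ℝ, x ⬝ᵥ (P *ᵥ x) =
      ∑ l, P (Sum.inl l) (Sum.inl l) * x (Sum.inl l) ^ 2 +
      ∑ h, P (Sum.inr (h, 1)) (Sum.inr (h, 1)) *
        (x (Sum.inr (h, 0)) ^ 2 + x (Sum.inr (h, 1)) ^ 2) := by
    intro x
    have h1 : P *ᵥ x = fun a => P a a * x a := by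
      funext a
      conv_lhs => rw [hdiag]
      rw [mulVec_diagonal]
    rw [h1, dotProduct, Fintype.sum_sum_type, Fintype.sum_prod_type]
    simp only [Fin.sum_univ_two]
    congr 1
    · exact Finset.sum_congr rfl fun l _ => by ring
    · refine Finset.sum_congr rfl fun h _ => ?_
      rw [heq h]; ring
  rintro x ⟨hx1, hx2⟩
  refine le_trans ?_ hbdry
  rw [hform, hform]
  refine add_le_add (Finset.sum_le_sum fun l _ => ?_) (Finset.sum_le_sum fun h _ => ?_)
  · refine mul_le_mul_of_nonneg_left ?_ (hpos _).le
    have : x (Sum.inl l) ^ 2 ≤ 1 := (sq_le_one_iff_abs_le_one _).2 (hx1 l)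
    simpa [boundaryVec] using this
  · refine mul_le_mul_of_nonneg_left ?_ (hpos _).le
    have h1 := hx2 h
    rw [Real.sqrt_le_one] at h1
    simpa [boundaryVec] using h1

end Exosystem

/-! ### Feasibility, approximate minimizers and the synchronization property. -/

section OptimizationProblem

open Matrix

variable {n m p m₀ N : ℕ} {mult : Fin N → ℕ} {ω : Fin N → ℝ}
  {A : Matrix (Fin n) (Fin n) ℝ} {B : Matrix (Fin n) (Fin m) ℝ} {C : Matrix (Fin p) (Fin n) ℝ}
  {Cbar : Matrix (Fin p) (ExoIdx m₀ mult) ℝ} {R : Matrix (Fin m) (Fin m) ℝ} {ε : Fin p → ℝ}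

/-- The Hamiltonian block equation splits into the regulator equation and the costate equation. -/
theorem hamiltonian_iff {ι : Type*} [Fintype ι] {Abar : Matrix ι ι ℝ} {Cbar : Matrix (Fin p) ι ℝ}
    {Q : Matrix (Fin p) (Fin p) ℝ} {Pi PiLam : Matrix (Fin n) ι ℝ} {Gam : Matrix (Fin m) ι ℝ}
    (hGam : Gam = -(R⁻¹ * Bᵀ * PiLam)) :
    Matrix.fromRows Pi PiLam * Abar =
      Matrix.fromBlocks A (-(B * R⁻¹ * Bᵀ)) (-(Cᵀ * Q * C)) (-Aᵀ) * Matrix.fromRows Pi PiLam +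
        Matrix.fromRows 0 (Cᵀ * Q * Cbar) ↔
    Pi * Abar = A * Pi + B * Gam ∧
      PiLam * Abar = -(Aᵀ * PiLam) - Cᵀ * Q * (C * Pi - Cbar) := by
  have h1 : ∀ (X Y : Matrix (Fin n) ι ℝ) (X' Y' : Matrix (Fin n) ι ℝ),
      Matrix.fromRows X Y + Matrix.fromRows X' Y' = Matrix.fromRows (X + X') (Y + Y') := by
    intro X Y X' Y'
    ext a b
    rcases a with a | a <;> simp
  rw [fromRows_mul, fromBlocks_mul_fromRows, h1, fromRows_ext_iff]
  refine and_congr ?_ ?_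
  · rw [hGam, add_zero, Matrix.neg_mul, Matrix.mul_neg]
    simp only [Matrix.mul_assoc]
  · have h2 : -(Cᵀ * Q * C) * Pi + -Aᵀ * PiLam + Cᵀ * Q * Cbar =
        -(Aᵀ * PiLam) - Cᵀ * Q * (C * Pi - Cbar) := by
      rw [Matrix.neg_mul, Matrix.neg_mul, Matrix.mul_sub, Matrix.mul_assoc (Cᵀ * Q) C Pi]
      abel
    rw [h2]

/-- P serves twice: as an invariant it bounds the exosystem trajectories, which optimality needs,
and it confines them to the ellipsoid where the errors are small. -/
theorem BMIFeasible.isEBOSS (hAC : IsDetectable A C) (hR : R.PosDef) (hε : ∀ j, 0 < ε j)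
    {z : BMIVars n m p (ExoIdx m₀ mult)} (hz : BMIFeasible ω A B C Cbar R ε z) :
    IsEBOSS A B C (exoMatrix m₀ mult ω) Cbar z.Q R (ellipsoid z.P) ε z.Pi z.Gam := by
  obtain ⟨hPi, hL⟩ := (hamiltonian_iff hz.gam_eq).1 hz.hamiltonian
  have hdet : IsUnit R.det := (Matrix.isUnit_iff_isUnit_det R).1 hR.isUnit
  have hG : R * z.Gam = -(Bᵀ * z.PiLam) := by
    rw [hz.gam_eq, Matrix.mul_neg, Matrix.mul_assoc R⁻¹, Matrix.mul_nonsing_inv_cancel_left _ _ hdet]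
  refine ⟨isOSS_of_hamiltonian hAC hz.Q_pos hR hPi hL hG
    (exists_norm_exoTraj_le hz.P_pos hz.lyapunov), fun xbar0 hx t ht j => ?_⟩
  refine abs_mulVec_le_of_fromBlocks_posDef hz.schur ?_ (hε j).le (hz.X_diag j)
  rw [dotProduct_mulVec_exoTraj hz.lyapunov xbar0 ht]
  exact hx

theorem IsEBOSS.mono {ι : Type*} [Fintype ι] [DecidableEq ι] {Abar : Matrix ι ι ℝ}
    {Cbar : Matrix (Fin p) ι ℝ} {Q : Matrix (Fin p) (Fin p) ℝ} {S S' : Set (ι → ℝ)}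
    {Pi : Matrix (Fin n) ι ℝ} {Gam : Matrix (Fin m) ι ℝ} (hS : S ⊆ S')
    (h : IsEBOSS A B C Abar Cbar Q R S' ε Pi Gam) : IsEBOSS A B C Abar Cbar Q R S ε Pi Gam :=
  ⟨h.1, fun x hx => h.2 x (hS hx)⟩

theorem BMIFeasible.normalizedSet_subset (hω : ∀ j, 0 < ω j)
    {z : BMIVars n m p (ExoIdx m₀ mult)} (hz : BMIFeasible ω A B C Cbar R ε z) :
    normalizedSet m₀ mult ⊆ ellipsoid z.P :=
  normalizedSet_subset_ellipsoid hω hz.P_pos hz.P_blockDiagonal hz.lyapunov hz.boundary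

/-- The optimization problem is feasible if the exact regulator equations are solvable. -/
theorem exists_bmiFeasible (hR : R.PosDef) (hε : ∀ j, 0 < ε j)
    {Pi₀ : Matrix (Fin n) (ExoIdx m₀ mult) ℝ} {Gam₀ : Matrix (Fin m) (ExoIdx m₀ mult) ℝ}
    (h₀ : Pi₀ * exoMatrix m₀ mult ω = A * Pi₀ + B * Gam₀) (hC₀ : C * Pi₀ = Cbar) :
    ∃ z : BMIVars n m p (ExoIdx m₀ mult), BMIFeasible ω A B C Cbar R ε z := by
  set b : ℝ := (boundaryVec : ExoIdx m₀ mult → ℝ) ⬝ᵥ boundaryVec with hb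
  have hb0 : 0 ≤ b := Finset.sum_nonneg fun i _ => mul_self_nonneg _
  -- A multiple of the identity solves the Lyapunov equation of a skew matrix. The summand 1 covers
  -- b = 0, an exosystem without states.
  set P : Matrix (ExoIdx m₀ mult) (ExoIdx m₀ mult) ℝ := (1 / (b + 1)) • 1 with hP_def
  have hP : P.PosDef := PosDef.one.smul (by positivity)
  set X : Matrix (Fin p) (Fin p) ℝ := diagonal fun j => ε j ^ 2 with hX_def
  have hX : X.PosDef := PosDef.diagonal fun j => pow_pos (hε j) 2
  obtain ⟨δ, hδ, hE⟩ := exists_posDef_fromBlocks hP hX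
  set M := (Gam₀ᵀ * R * Gam₀).trace with hM
  have hM0 : 0 ≤ M := trace_weighted_nonneg hR Gam₀
  obtain ⟨Pi, Gam, PiLam, hPi, hL, hG, hbound⟩ := exists_hamiltonian_solution hR
    -- Then qδ² ≥ M, so the squared Frobenius norm of the error is at most δ². The summand 1 keeps q
    -- positive when M = 0.
    (exoMatrix_transpose ω) h₀ hC₀ (q := M / δ ^ 2 + 1) (by positivity)
  have hdet : IsUnit R.det := (Matrix.isUnit_iff_isUnit_det R).1 hR.isUnit
  have hGam : Gam = -(R⁻¹ * Bᵀ * PiLam) := by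
    rw [Matrix.mul_assoc, ← Matrix.mul_neg, ← hG, Matrix.nonsing_inv_mul_cancel_left _ _ hdet]
  refine ⟨⟨Pi, Gam, PiLam, (M / δ ^ 2 + 1) • 1, P, X⟩, ?_⟩
  exact
    { Q_pos := PosDef.one.smul (by positivity)
      hamiltonian := (hamiltonian_iff hGam).2 ⟨hPi, hL⟩
      gam_eq := hGam
      P_pos := hP
      P_blockDiagonal := by
        intro i j hij
        have : i ≠ j := fun h => hij (by rw [h])
        simp [hP_def, this]
      lyapunov := by
        simp [hP_def, exoMatrix_transpose]
      boundary := by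
        simp only [hP_def]
        rw [Matrix.smul_mulVec, Matrix.one_mulVec, dotProduct_smul, ← hb, smul_eq_mul,
          one_div_mul_eq_div, div_le_one (by positivity)]
        linarith
      X_pos := hX
      X_diag := fun j => by simp [hX_def]
      schur := by
        refine hE _ fun i j => abs_le_of_sq_le_sq ?_ hδ.le
        refine (sq_entry_le_trace _ i j).trans ?_
        have h1 : (M / δ ^ 2 + 1) * ((C * Pi - Cbar)ᵀ * (C * Pi - Cbar)).trace ≤
            (M / δ ^ 2 + 1) * δ ^ 2 := by
          refine hbound.trans ?_
          rw [add_mul, div_mul_cancel₀ _ (by positivity)]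
          nlinarith [sq_nonneg δ]
        exact le_of_mul_le_mul_left h1 (by positivity) }

/-- Only the infimum is approached: the strict matrix inequalities need not define a closed set, so
attainment is not claimed. -/
theorem exists_isBMIMinimizer (hR : R.PosDef)
    (hfeas : ∃ z : BMIVars n m p (ExoIdx m₀ mult), BMIFeasible ω A B C Cbar R ε z) {η : ℝ}
    (hη : 0 < η) :
    ∃ z : BMIVars n m p (ExoIdx m₀ mult), IsBMIMinimizer ω A B C Cbar R ε η z := by
  set S : Set ℝ := bmiObjective R '' {z : BMIVars n m p (ExoIdx m₀ mult) |
    BMIFeasible ω A B C Cbar R ε z} with hS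
  have hne : S.Nonempty := let ⟨z, hz⟩ := hfeas; ⟨_, z, hz, rfl⟩
  have hbdd : BddBelow S := ⟨0, by
    rintro _ ⟨z, -, rfl⟩
    exact trace_weighted_nonneg hR z.Gam⟩
  obtain ⟨_, ⟨z, hz, rfl⟩, hlt⟩ := Real.lt_sInf_add_pos hne hη
  exact ⟨z, hz, fun z' hz' => hlt.le.trans
    (add_le_add_left (csInf_le hbdd ⟨z', hz', rfl⟩) η)⟩

end OptimizationProblem

end OptSync

theorem mainTheorem3 {n m p m₀ N : ℕ}
    (mult : Fin N → ℕ) (hmult : ∀ j, 0 < mult j)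
    (ω : Fin N → ℝ) (hω : ∀ j, 0 < ω j) (hω_inj : Function.Injective ω)
    (hω_ratio : ∀ i j, ∃ q : ℚ, ω i / ω j = (q : ℝ))
    (A : Matrix (Fin n) (Fin n) ℝ) (B : Matrix (Fin n) (Fin m) ℝ) (C : Matrix (Fin p) (Fin n) ℝ)
    (hAB : IsStabilizable A B) (hAC : IsDetectable A C)
    (Cbar : Matrix (Fin p) (ExoIdx m₀ mult) ℝ)
    (hEXS : ∃ (Pi : Matrix (Fin n) (ExoIdx m₀ mult) ℝ) (Gam : Matrix (Fin m) (ExoIdx m₀ mult) ℝ),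
      Pi * exoMatrix m₀ mult ω = A * Pi + B * Gam ∧ C * Pi - Cbar = 0)
    (R : Matrix (Fin m) (Fin m) ℝ) (hR : R.PosDef)
    (ε : Fin p → ℝ) (hε : ∀ j, 0 < ε j) :
    (∀ η : ℝ, 0 < η → ∃ z : BMIVars n m p (ExoIdx m₀ mult),
      IsBMIMinimizer ω A B C Cbar R ε η z) ∧
    (∀ (η : ℝ) (z : BMIVars n m p (ExoIdx m₀ mult)), IsBMIMinimizer ω A B C Cbar R ε η z →
      IsEBOSS A B C (exoMatrix m₀ mult ω) Cbar z.Q R (normalizedSet m₀ mult) ε z.Pi z.Gam) ∧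
    (∀ z : BMIVars n m p (ExoIdx m₀ mult), BMIFeasible ω A B C Cbar R ε z →
      normalizedSet m₀ mult ⊆ ellipsoid z.P ∧
      IsEBOSS A B C (exoMatrix m₀ mult ω) Cbar z.Q R (ellipsoid z.P) ε z.Pi z.Gam) := by
  obtain ⟨Pi₀, Gam₀, h₀, hC₀⟩ := hEXS
  refine ⟨fun η hη => exists_isBMIMinimizer hR
    (exists_bmiFeasible hR hε h₀ (sub_eq_zero.1 hC₀)) hη, fun η z hz => ?_, fun z hz => ?_⟩
  · exact (hz.1.isEBOSS hAC hR hε).mono (hz.1.normalizedSet_subset hω)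
  · exact ⟨hz.normalizedSet_subset hω, hz.isEBOSS hAC hR hε⟩
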